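/- **Setting.** Let $\lambda\ge 0$, $\sigma_1>0$, $\sigma_2\ge 0$, $\kappa,\rho,\delta>0$, and put $$a_1=\tfrac14\bigl(\sqrt{\delta^2\rho^2+4\kappa\rho}-\delta\rho\bigr),\quad a_3=\frac{2a_1\rho}{\delta\rho+\lambda\rho+2a_1},\quad a_2=\frac{a_3(2\rho-a_3)}{2\rho(2\lambda+\delta)},\quad \bar a=a_3-a_2(2\lambda+\delta)=\frac{a_3^2}{2\rho}>0,$$ $$f(\gamma,h)=-(\sigma_1^{-2}+h)\gamma^2-2\lambda\gamma+\sigma_2^2 .$$ Let $c:[0,\infty)\to[0,\infty)$ be strictly increasing, strictly convex, continuously differentiable on $[0,\infty)$ and twice continuously differentiable on $(0,\infty)$. Fix $\gamma_{\max}>-\lambda\sigma_1^2+\sqrt{\lambda^2\sigma_1^4+\sigma_1^2\sigma_2^2}$, set $M_0=\gamma_{\max}^2\bar a/\delta$, and assume that $M_0\in c'([0,\infty))$, so that $h_{\max}:=(c')^{-1}(M_0)\ge 0$ is well defined. Let $\mathcal A$ be the set of Borel functions $h:[0,\infty)\to[0,h_{\max}]$. For $h\in\mathcal A$ and $\gamma_0\in[0,\gamma_{\max}]$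 let $\gamma^{h;\gamma_0}$ be the absolutely continuous solution of $\mathrm d\gamma_t=f(\gamma_t,h_t)\,\mathrm dt$ on $[0,\infty)$ with initial value $\gamma_0$, and put $$\mathcal J(h;\gamma_0)=\int_0^\infty e^{-\delta t}\bigl(\bar a\,\gamma_t^{h;\gamma_0}+c(h_t)\bigr)\mathrm dt,\qquad v(\gamma_0)=\inf_{h\in\mathcal A}\mathcal J(h;\gamma_0).$$ A control $h\in\mathcal A$ is optimal for $\gamma_0$ if $\mathcal J(h;\gamma_0)=v(\gamma_0)$. Derivatives of functions on $[0,\gamma_{\max}]$ are one-sided at the end points. Let $\hat h(x)=\arg\max_{h\in[0,h_{\max}]}\{hx-c(h)\}$ and $H^*(\gamma)=\hat h\bigl(\gamma^2v'(\gamma)\bigr)$ for $\gamma\in[0,\gamma_{\max}]$. **Theorem.** For all $h\in\mathcal A$ and $\gamma_0\in[0,\gamma_{\max}]$ the solution $\gamma^{h;\gamma_0}$ exists, is unique and $[0,\gamma_{\max}]$-valued, and the integral defining $\mathcal J(h;\gamma_0)$ converges. The value function $v$ is continuously differentiable on $[0,\gamma_{\max}]$ and solves the reduced Hamilton–Jacobi–Bellman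 equation $$-\delta v(\gamma)+\inf_{h\in[0,\infty)}\bigl\{f(\gamma,h)v'(\gamma)+\bar a\gamma+c(h)\bigr\}=0,\qquad \gamma\in[0,\gamma_{\max}].$$ Moreover, for every $\gamma_0\in[0,\gamma_{\max}]$ the closed-loop equation $\mathrm d\gamma^*_t=f\bigl(\gamma^*_t,H^*(\gamma^*_t)\bigr)\mathrm dt$, $\gamma^*_0=\gamma_0$, has a unique $[0,\gamma_{\max}]$-valued solution $\gamma^*$ on $[0,\infty)$; the feedback control $h^*=H^*(\gamma^*)$ is continuous and belongs to $\mathcal A$, $\gamma^*=\gamma^{h^*;\gamma_0}$, and $h^*$ is the unique continuous optimal control for $\gamma_0$. -/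

import Mathlib

noncomputable section

/-- The data of the problem: mean-reversion speed `lam`, volatilities `sig1`, `sig2`, cost
coefficients `kap` (state) and `rho` (control), discount rate `del`, upper end `gmax` of the
state space of the conditional variance, and the cost `c` of information acquisition (only the
values of `c` on `[0,∞)` matter). -/
structure AcqModel where
  lam : ℝ
  sig1 : ℝ
  sig2 : ℝ
  kap : ℝ
  rho : ℝ
  del : ℝ
  gmax : ℝ
  c : ℝ → ℝ

namespace AcqModel

variable (P : AcqModel)

/-- The coefficient `a₁` of the quadratic ansatz. -/
def a1 : ℝ := -(P.del * P.rho) / 4 + Real.sqrt (P.del ^ 2 * P.rho ^ 2 + 4 * P.kap * P.rho) / 4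

/-- The coefficient `a₃` of the quadratic ansatz. -/
def a3 : ℝ := 2 * P.a1 * P.rho / (P.del * P.rho + P.lam * P.rho + 2 * P.a1)

/-- The coefficient `a₂` of the quadratic ansatz. -/
def a2 : ℝ := P.a3 * (2 * P.rho - P.a3) / (2 * P.rho * (2 * P.lam + P.del))

/-- The weight of the conditional variance in the reduced running cost. -/
def abar : ℝ := P.a3 - P.a2 * (2 * P.lam + P.del)

/-- The equilibrium of the uncontrolled conditional variance. -/
def gammaInf : ℝ :=
  -(P.lam * P.sig1 ^ 2) + Real.sqrt (P.lam ^ 2 * P.sig1 ^ 4 + P.sig1 ^ 2 * P.sig2 ^ 2)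

/-- The right-hand side of the Riccati equation. -/
def f (g h : ℝ) : ℝ := -((1 / P.sig1) ^ 2 + h) * g ^ 2 - 2 * P.lam * g + P.sig2 ^ 2

/-- The derivative of the cost on `[0,∞)`, one-sided at `0`. -/
def cDeriv (h : ℝ) : ℝ := derivWithin P.c (Set.Ici 0) h

/-- `L_v = ā / δ`. -/
def Lv : ℝ := P.abar / P.del

/-- `M₀ = γ_max² L_v`. -/
def M0 : ℝ := P.gmax ^ 2 * P.Lv

/-- `h_max = (c')⁻¹(M₀)`, the inverse being that of `c'` on `[0,∞)`. -/
def hmax : ℝ := Function.invFunOn P.cDeriv (Set.Ici 0) P.M0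

/-- The standing assumptions. The last one says that `h_max` is well defined. -/
structure Standing : Prop where
  lam_nonneg : 0 ≤ P.lam
  sig1_pos : 0 < P.sig1
  sig2_nonneg : 0 ≤ P.sig2
  kap_pos : 0 < P.kap
  rho_pos : 0 < P.rho
  del_pos : 0 < P.del
  gmax_gt : P.gammaInf < P.gmax
  c_nonneg : ∀ h, 0 ≤ h → 0 ≤ P.c h
  c_strictMono : StrictMonoOn P.c (Set.Ici 0)
  c_strictConvex : StrictConvexOn ℝ (Set.Ici 0) P.c
  c_contDiff_one : ContDiffOn ℝ 1 P.c (Set.Ici 0)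
  c_contDiff_two : ContDiffOn ℝ 2 P.c (Set.Ioi 0)
  M0_mem : P.M0 ∈ P.cDeriv '' Set.Ici 0

/-- Admissible rates: Borel functions `[0,∞) → [0, h_max]`. Functions of time are total functions
on `ℝ` of which only the restriction to `[0,∞)` is used. -/
def Adm : Set (ℝ → ℝ) :=
  {h | Measurable ((Set.Ici (0 : ℝ)).domRestrict h) ∧ ∀ t, 0 ≤ t → h t ∈ Set.Icc 0 P.hmax}

/-- `g` is an absolutely continuous solution on `[0,∞)` of `dγ = f(γ,h) dt`, `γ₀ = g0`
(in integral form). -/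
def IsState (h : ℝ → ℝ) (g0 : ℝ) (g : ℝ → ℝ) : Prop :=
  ContinuousOn g (Set.Ici 0) ∧
    ∀ t, 0 ≤ t → g t = g0 + ∫ s in (0 : ℝ)..t, P.f (g s) (h s)

/-- The state `γ^{h;g0}`, the solution of the state equation. -/
def state (h : ℝ → ℝ) (g0 : ℝ) : ℝ → ℝ := Classical.epsilon (P.IsState h g0)

/-- The running cost `k(γ,h) = ā γ + c(h)`. -/
def k (g h : ℝ) : ℝ := P.abar * g + P.c h

/-- The cost functional of the reduced problem. -/
def cost (h : ℝ → ℝ) (g0 : ℝ) : ℝ :=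
  ∫ t in Set.Ioi (0 : ℝ), Real.exp (-P.del * t) * P.k (P.state h g0 t) (h t)

/-- The value function of the reduced problem, of interest on `[0, γ_max]`. -/
def value (g0 : ℝ) : ℝ := sInf ((fun h => P.cost h g0) '' P.Adm)

/-- `h` is an optimal control for the initial value `g0`. -/
def IsOptimal (h : ℝ → ℝ) (g0 : ℝ) : Prop := h ∈ P.Adm ∧ P.cost h g0 = P.value g0

/-- The derivative on `[0, γ_max]`, one-sided at the two end points. -/
def D (w : ℝ → ℝ) (g : ℝ) : ℝ := derivWithin w (Set.Icc 0 P.gmax) g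

/-- `w` is a classical solution on `[0, γ_max]` of
`-δ w + inf_{h ∈ [0,∞)} {f(γ,h) w' + ā γ + c(h)} = 0`. -/
def SolvesHJB (w : ℝ → ℝ) : Prop :=
  ContDiffOn ℝ 1 w (Set.Icc 0 P.gmax) ∧
    ∀ g ∈ Set.Icc 0 P.gmax,
      BddBelow ((fun h => P.f g h * P.D w g + P.abar * g + P.c h) '' Set.Ici 0) ∧
      -P.del * w g + sInf ((fun h => P.f g h * P.D w g + P.abar * g + P.c h) '' Set.Ici 0) = 0

/-- `ĥ(x) = argmax_{h ∈ [0, h_max]} (h x - c(h))`. -/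
def hHat (x : ℝ) : ℝ :=
  Classical.epsilon fun h =>
    h ∈ Set.Icc 0 P.hmax ∧ IsMaxOn (fun h' => h' * x - P.c h') (Set.Icc 0 P.hmax) h

/-- The feedback map `H*(γ) = ĥ(γ² v'(γ))`. -/
def Hstar (g : ℝ) : ℝ := P.hHat (g ^ 2 * P.D P.value g)

/-- `g` is a `[0, γ_max]`-valued solution on `[0,∞)` of the closed-loop equation
`dγ = f(γ, H*(γ)) dt`, `γ₀ = g0`. -/
def IsClosedLoop (g0 : ℝ) (g : ℝ → ℝ) : Prop :=
  g 0 = g0 ∧ ∀ t, 0 ≤ t → g t ∈ Set.Icc 0 P.gmax ∧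
    HasDerivWithinAt g (P.f (g t) (P.Hstar (g t))) (Set.Ici 0) t

end AcqModel

end

/-! The value function is concave in `γ` and convex in the precision `1/γ`. Together these force it
to be continuously differentiable, so dynamic programming gives the HJB equation classically,
without viscosity solutions.

For a fixed control the Riccati field is decreasing and concave in `γ ≥ 0`. Its flow is therefore
monotone, nonexpansive and concave in the initial value, and `v`, an infimum of costs with the same
properties, is nondecreasing, concave and Lipschitz with constant `ā/δ`. In the variable `y = 1/γ`
the drift is affine in `h` and concave in `y`. Mixing two controls and the two initial precisions
thus gives at least the mixed precision (`mix_inv_le`), hence at most the mixed state. As `c` is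
convex, `y ↦ v(1/y)` is convex (`convexOn_value_inv`). The two curvature properties allow kinks of
opposite sign only, so there are none; a Darboux argument makes `v'` continuous. Convexity in `1/γ`
also makes `γ² v'(γ)` nondecreasing.

Let `gap` be the expression in the HJB equation. The chain rule gives cost = `v` + discounted
integral of `gap` along the state (`cost_eq_value_add`). Dynamic programming shows `gap ≥ 0`. Were
its minimum over `h` positive at some point, every control started there would lose a common
positive amount, contradicting the definition of `v`; so the minimum is zero (`gap_Hstar`). Rates
above `h_max` cannot help because `c'(h_max) = M₀` dominates `γ² v'(γ)`.

Finally `H*` is continuous and nondecreasing, so the closed-loop field is continuous and decreasing,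
which gives existence and uniqueness although it need not be Lipschitz. The feedback has zero gap
and is optimal. Conversely, optimality forces the gap to vanish almost everywhere, strict convexity
of `c` identifies the control there, and continuity removes the null set. -/

open Set MeasureTheory Filter Topology

/-! ### Scalar integral equations: comparison, existence, chain rule. -/

/-- Comparison principle for absolutely continuous functions in integral form. -/
theorem nonpos_of_eq_add_integral {x φ : ℝ → ℝ} {T L x0 : ℝ} (hx : ContinuousOn x (Icc 0 T))
    (hφ : IntervalIntegrable φ volume 0 T)
    (heq : ∀ t ∈ Icc 0 T, x t = x0 + ∫ s in (0 : ℝ)..t, φ s) (h0 : x0 ≤ 0) (hL : 0 ≤ L)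
    (hle : ∀ s ∈ Icc 0 T, 0 < x s → φ s ≤ L * x s) : ∀ t ∈ Icc 0 T, x t ≤ 0 := by
  intro t1 ht1
  by_contra! hpos
  have hsub : Icc 0 t1 ⊆ Icc 0 T := Icc_subset_Icc_right ht1.2
  have hS : IsCompact (Icc 0 t1 ∩ x ⁻¹' Iic 0) :=
    isCompact_Icc.of_isClosed_subset
      ((hx.mono hsub).preimage_isClosed_of_isClosed isClosed_Icc isClosed_Iic) inter_subset_left
  have hx0 : x 0 = x0 := by simpa using heq 0 ⟨le_rfl, ht1.1.trans ht1.2⟩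
  have hne : (Icc 0 t1 ∩ x ⁻¹' Iic 0).Nonempty := ⟨0, ⟨le_rfl, ht1.1⟩, by simp [hx0, h0]⟩
  obtain ⟨ht0, ht0x⟩ := hS.sSup_mem hne
  -- The last time before `t1` at which `x ≤ 0`; beyond it the bound on `φ` is available.
  set t0 := sSup (Icc 0 t1 ∩ x ⁻¹' Iic 0) with ht0def
  have hx_pos : ∀ s ∈ Ioc t0 t1, 0 < x s := by
    intro s hs
    by_contra! hcon
    exact absurd (le_csSup hS.bddAbove ⟨⟨ht0.1.trans hs.1.le, hs.2⟩, hcon⟩) (not_le.2 hs.1)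
  have ht01 : t0 < t1 := by
    rcases ht0.2.eq_or_lt with h | h
    · rw [h] at ht0x; exact absurd ht0x (not_le.2 hpos)
    · exact h
  -- On so short an interval the maximum `x m > 0` satisfies `x m ≤ x t0 + x m / 2 ≤ x m / 2`, a
  -- contradiction that replaces Gronwall's inequality.
  obtain ⟨t2, ht2, ht2'⟩ : ∃ t2, t2 ∈ Ioc t0 t1 ∧ L * (t2 - t0) ≤ 1 / 2 := by
    refine ⟨min t1 (t0 + 1 / (2 * (L + 1))), ⟨lt_min ht01 (by simp; positivity), min_le_left _ _⟩, ?_⟩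
    have h1 : min t1 (t0 + 1 / (2 * (L + 1))) - t0 ≤ 1 / (2 * (L + 1)) := by
      linarith [min_le_right t1 (t0 + 1 / (2 * (L + 1)))]
    calc _ ≤ L * (1 / (2 * (L + 1))) := by gcongr
      _ ≤ _ := by
        rw [mul_one_div, div_le_div_iff₀ (by positivity) (by norm_num)]; linarith
  have hsub2 : Icc t0 t2 ⊆ Icc 0 T := fun s hs => ⟨ht0.1.trans hs.1, hs.2.trans (ht2.2.trans ht1.2)⟩
  obtain ⟨m, hm, hmax⟩ := isCompact_Icc.exists_isMaxOn (nonempty_Icc.2 ht2.1.le) (hx.mono hsub2)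
  have hM : 0 < x m := (hx_pos t2 ht2).trans_le (hmax ⟨ht2.1.le, le_rfl⟩)
  have hii : ∀ a b, a ∈ Icc 0 T → b ∈ Icc 0 T → IntervalIntegrable φ volume a b :=
    fun a b ha hb => hφ.mono_set (by
      rw [uIcc_of_le (ha.1.trans ha.2)]; exact ordConnected_Icc.uIcc_subset ha hb)
  have h0T : (0 : ℝ) ∈ Icc 0 T := ⟨le_rfl, ht1.1.trans ht1.2⟩
  have hkey : x m = x t0 + ∫ s in t0..m, φ s := by
    rw [heq m (hsub2 hm), heq t0 (hsub2 ⟨le_rfl, ht2.1.le⟩), add_assoc,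
      intervalIntegral.integral_add_adjacent_intervals
        (hii _ _ h0T (hsub2 ⟨le_rfl, ht2.1.le⟩)) (hii _ _ (hsub2 ⟨le_rfl, ht2.1.le⟩) (hsub2 hm))]
  have hint : ∫ s in t0..m, φ s ≤ ∫ s in t0..m, L * x m := by
    refine intervalIntegral.integral_mono_on_of_le_Ioo hm.1
      (hii _ _ (hsub2 ⟨le_rfl, ht2.1.le⟩) (hsub2 hm)) (by simp) fun s hs => ?_
    have hs' : s ∈ Icc t0 t2 := ⟨hs.1.le, hs.2.le.trans hm.2⟩
    refine (hle s (hsub2 hs') (hx_pos s ⟨hs.1, hs'.2.trans ht2.2⟩)).trans ?_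
    exact mul_le_mul_of_nonneg_left (hmax hs') hL
  rw [intervalIntegral.integral_const, smul_eq_mul] at hint
  have h3 : (m - t0) * (L * x m) ≤ 1 / 2 * x m := by
    calc (m - t0) * (L * x m) = (L * (m - t0)) * x m := by ring
      _ ≤ _ := by
        gcongr
        exact (mul_le_mul_of_nonneg_left (by linarith [hm.2]) hL).trans ht2'
  have : x t0 ≤ 0 := ht0x
  linarith

/-- Global Carathéodory existence for bounded right-hand sides that are Lipschitz in the state. -/
theorem exists_continuous_eq_add_integral {F : ℝ → ℝ → ℝ} {C L : ℝ} (hL : 0 < L)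
    (hmeas : ∀ u : ℝ → ℝ, Continuous u → Measurable fun s => F s (u s))
    (hbd : ∀ s x, |F s x| ≤ C) (hlip : ∀ s x y, |F s x - F s y| ≤ L * |x - y|) (x0 : ℝ) :
    ∃ x : ℝ → ℝ, Continuous x ∧ ∀ t, 0 ≤ t → x t = x0 + ∫ s in (0 : ℝ)..t, F s (x s) := by
  have hC : 0 ≤ C := (abs_nonneg _).trans (hbd 0 0)
  have hint : ∀ u : ℝ → ℝ, Continuous u → ∀ a b,
      IntervalIntegrable (fun s => F s (u s)) volume a b := by
    intro u hu a b
    refine (intervalIntegrable_const (c := C)).mono_fun' (hmeas u hu).aestronglyMeasurable ?_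
    exact ae_of_all _ fun s => hbd _ _
  -- Exponentially weighted sup norm: the unknown is `u t = exp (-K t) x t`, for which the Picard
  -- map contracts globally in time with factor `L / K = 1/2`.
  set K := 2 * L with hK
  have hKpos : 0 < K := by positivity
  let e : BoundedContinuousFunction ℝ ℝ → ℝ → ℝ := fun u s => Real.exp (K * s) * u s
  have he : ∀ u, Continuous (e u) := fun u =>
    (Real.continuous_exp.comp (continuous_const.mul continuous_id)).mul u.continuous
  let G : BoundedContinuousFunction ℝ ℝ → ℝ → ℝ := fun u t =>
    Real.exp (-(K * max t 0)) * (x0 + ∫ s in (0 : ℝ)..(max t 0), F s (e u s))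
  have hGc : ∀ u, Continuous (G u) := by
    intro u
    have h1 : Continuous fun t : ℝ => ∫ s in (0 : ℝ)..t, F s (e u s) :=
      intervalIntegral.continuous_primitive (hint _ (he u)) 0
    have h2 : Continuous fun t : ℝ => max t 0 := by fun_prop
    exact (by fun_prop : Continuous fun t : ℝ => Real.exp (-(K * max t 0))).mul
      (continuous_const.add (h1.comp h2))
  have hGb : ∀ u t, ‖G u t‖ ≤ |x0| + C / K := by
    intro u t
    have hm : 0 ≤ max t 0 := le_max_right _ _
    have h1 : |∫ s in (0 : ℝ)..(max t 0), F s (e u s)| ≤ C * |max t 0 - 0| := by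
      rw [← Real.norm_eq_abs]
      exact intervalIntegral.norm_integral_le_of_norm_le_const fun s _ => hbd _ _
    rw [sub_zero, abs_of_nonneg hm] at h1
    have h2 : Real.exp (-(K * max t 0)) ≤ 1 := Real.exp_le_one_iff.2 (by nlinarith)
    have h3 : Real.exp (-(K * max t 0)) * (K * max t 0) ≤ 1 := by
      rw [Real.exp_neg, inv_mul_le_iff₀ (Real.exp_pos _), mul_one]
      linarith [Real.add_one_le_exp (K * max t 0)]
    have h4 := (Real.exp_pos (-(K * max t 0))).le
    rw [Real.norm_eq_abs, abs_mul, abs_of_nonneg h4]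
    calc _ ≤ Real.exp (-(K * max t 0)) * (|x0| + C * max t 0) := by
            gcongr; exact (abs_add_le _ _).trans (by linarith)
      _ = Real.exp (-(K * max t 0)) * |x0|
          + C / K * (Real.exp (-(K * max t 0)) * (K * max t 0)) := by field_simp
      _ ≤ 1 * |x0| + C / K * 1 := by gcongr
      _ = _ := by ring
  let T : BoundedContinuousFunction ℝ ℝ → BoundedContinuousFunction ℝ ℝ := fun u =>
    BoundedContinuousFunction.ofNormedAddCommGroup (G u) (hGc u) _ (hGb u)
  have hT : ContractingWith (1 / 2) T := by
    refine ⟨by rw [← NNReal.coe_lt_coe]; norm_num, LipschitzWith.of_dist_le_mul fun u w => ?_⟩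
    rw [BoundedContinuousFunction.dist_le (by positivity)]
    intro t
    have hm : 0 ≤ max t 0 := le_max_right _ _
    have h4 := (Real.exp_pos (-(K * max t 0))).le
    have hTG : ∀ z, T z t = G z t := fun z => rfl
    have hdiff : G u t - G w t = Real.exp (-(K * max t 0)) *
        ∫ s in (0 : ℝ)..(max t 0), (F s (e u s) - F s (e w s)) := by
      rw [intervalIntegral.integral_sub (hint _ (he u) _ _) (hint _ (he w) _ _)]
      simp only [G]; ring
    have h5 : |∫ s in (0 : ℝ)..(max t 0), (F s (e u s) - F s (e w s))| ≤
        ∫ s in (0 : ℝ)..(max t 0), L * dist u w * Real.exp (K * s) := by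
      rw [← Real.norm_eq_abs]
      refine intervalIntegral.norm_integral_le_of_norm_le hm (ae_of_all _ fun s _ => ?_) ?_
      · refine (hlip _ _ _).trans ?_
        have : e u s - e w s = Real.exp (K * s) * (u s - w s) := by simp only [e]; ring
        rw [this, abs_mul, abs_of_pos (Real.exp_pos _)]
        calc L * (Real.exp (K * s) * |u s - w s|) = L * |u s - w s| * Real.exp (K * s) := by ring
          _ ≤ L * dist u w * Real.exp (K * s) := by
            have := BoundedContinuousFunction.dist_coe_le_dist (f := u) (g := w) s
            rw [Real.dist_eq] at this
            gcongr
      · exact Continuous.intervalIntegrable (by fun_prop) _ _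
    have h6 : ∫ s in (0 : ℝ)..(max t 0), L * dist u w * Real.exp (K * s) =
        L * dist u w * ((Real.exp (K * max t 0) - 1) / K) := by
      rw [intervalIntegral.integral_const_mul,
        intervalIntegral.integral_comp_mul_left (fun s => Real.exp s) hKpos.ne', integral_exp,
        smul_eq_mul, mul_zero, Real.exp_zero, inv_mul_eq_div]
    rw [h6] at h5
    rw [hTG, hTG, Real.dist_eq, hdiff, abs_mul, abs_of_nonneg h4]
    have h7 : Real.exp (-(K * max t 0)) * Real.exp (K * max t 0) = 1 := by
      rw [← Real.exp_add]; simp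
    calc _ ≤ Real.exp (-(K * max t 0)) * (L * dist u w * ((Real.exp (K * max t 0) - 1) / K)) := by
            gcongr
      _ = (1 / 2) * dist u w * (Real.exp (-(K * max t 0)) * Real.exp (K * max t 0)
          - Real.exp (-(K * max t 0))) := by rw [hK]; field_simp
      _ ≤ (1 / 2) * dist u w * 1 := by
            rw [h7]; gcongr; linarith
      _ = _ := by simp
  have hfix := hT.fixedPoint_isFixedPt
  set u := ContractingWith.fixedPoint T hT
  refine ⟨e u, he u, fun t ht => ?_⟩
  have h8 : u t = G u t := by
    conv_lhs => rw [← hfix]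
    rfl
  simp only [G, max_eq_left ht] at h8
  have h7 : Real.exp (K * t) * Real.exp (-(K * t)) = 1 := by
    rw [← Real.exp_add]; simp
  change Real.exp (K * t) * u t = _
  rw [h8, ← mul_assoc, h7, one_mul]

/-- Discounted chain rule in integral form along an absolutely continuous path. -/
theorem exp_mul_comp_eq_add_integral {g φ w w' : ℝ → ℝ} {a b C C' T g0 : ℝ} (δ : ℝ) (hT : 0 ≤ T)
    (hφ : IntervalIntegrable φ volume 0 T) (hφb : ∀ s ∈ Icc 0 T, |φ s| ≤ C)
    (heq : ∀ t ∈ Icc 0 T, g t = g0 + ∫ s in (0 : ℝ)..t, φ s)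
    (hg : ∀ t ∈ Icc 0 T, g t ∈ Icc a b)
    (hw : ∀ z ∈ Icc a b, HasDerivWithinAt w (w' z) (Icc a b) z) (hw' : ∀ z ∈ Icc a b, |w' z| ≤ C') :
    Real.exp (-δ * T) * w (g T) = w g0 +
      ∫ s in (0 : ℝ)..T, Real.exp (-δ * s) * (w' (g s) * φ s - δ * w (g s)) := by
  have h0T : (0 : ℝ) ∈ Icc 0 T := ⟨le_rfl, hT⟩
  have hC : 0 ≤ C := (abs_nonneg _).trans (hφb 0 h0T)
  have hC' : 0 ≤ C' := (abs_nonneg _).trans (hw' _ (hg 0 h0T))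
  have hg0 : g 0 = g0 := by simpa using heq 0 h0T
  have hii : ∀ a b, a ∈ Icc 0 T → b ∈ Icc 0 T → IntervalIntegrable φ volume a b :=
    fun a b ha hb => hφ.mono_set (by
      rw [uIcc_of_le hT]; exact ordConnected_Icc.uIcc_subset ha hb)
  -- The path and `w` are both Lipschitz, so their composition is absolutely continuous and is the
  -- integral of its almost everywhere derivative.
  have hglip : LipschitzOnWith C.toNNReal g (Icc 0 T) := by
    refine LipschitzOnWith.of_dist_le_mul fun x hx y hy => ?_
    rw [Real.coe_toNNReal _ hC, Real.dist_eq, Real.dist_eq, heq x hx, heq y hy,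
      add_sub_add_left_eq_sub, intervalIntegral.integral_interval_sub_left (hii _ _ h0T hx)
        (hii _ _ h0T hy)]
    rw [← Real.norm_eq_abs]
    refine intervalIntegral.norm_integral_le_of_norm_le_const fun s hs => hφb s ?_
    exact ordConnected_Icc.uIcc_subset hy hx (uIoc_subset_uIcc hs)
  have hwlip : LipschitzOnWith C'.toNNReal w (Icc a b) := by
    refine (convex_Icc a b).lipschitzOnWith_of_nnnorm_hasDerivWithin_le hw fun z hz => ?_
    rw [← NNReal.coe_le_coe, Real.coe_toNNReal _ hC']; exact hw' z hz
  have hac1 : AbsolutelyContinuousOnInterval (fun t => w (g t)) 0 T := by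
    refine LipschitzOnWith.absolutelyContinuousOnInterval (K := C'.toNNReal * C.toNNReal) ?_
    rw [uIcc_of_le hT]
    exact hwlip.comp hglip hg
  have hac2 : AbsolutelyContinuousOnInterval (fun t => Real.exp (-δ * t)) 0 T :=
    ContDiffOn.absolutelyContinuousOnInterval (ContDiff.contDiffOn (by fun_prop))
  have hftc := (hac2.fun_mul hac1).integral_deriv_eq_sub
  simp only [mul_zero, Real.exp_zero, one_mul, hg0] at hftc
  rw [← sub_eq_iff_eq_add', ← hftc]
  refine intervalIntegral.integral_congr_ae ?_
  have hneT : ∀ᵐ x : ℝ, x ≠ T := by simp [ae_iff, measure_singleton]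
  filter_upwards [hφ.ae_hasDerivAt_integral, hneT] with s hs hsT hs'
  rw [uIoc_of_le hT] at hs'
  have hsI : s ∈ Ioo 0 T := ⟨hs'.1, lt_of_le_of_ne hs'.2 hsT⟩
  have hnhds : Icc 0 T ∈ 𝓝 s := Icc_mem_nhds hsI.1 hsI.2
  rw [uIcc_of_le hT] at hs
  have hd1 : HasDerivAt g (φ s) s := by
    refine ((hs (Ioo_subset_Icc_self hsI) 0 h0T).const_add g0).congr_of_eventuallyEq ?_
    filter_upwards [hnhds] with t ht using heq t ht
  have hd2 : HasDerivAt (fun t => w (g t)) (w' (g s) * φ s) s := by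
    have := (hw (g s) (hg s (Ioo_subset_Icc_self hsI))).comp s hd1.hasDerivWithinAt
      (s := Icc 0 T) hg
    exact this.hasDerivAt hnhds
  have hd3 : HasDerivAt (fun t => Real.exp (-δ * t)) (Real.exp (-δ * s) * (-δ)) s := by
    simpa using ((hasDerivAt_id s).const_mul (-δ)).exp
  rw [(hd3.fun_mul hd2).deriv]; ring

/-- Solvability of an autonomous dissipative equation on an interval. -/
theorem exists_eq_add_integral_of_antitoneOn {F : ℝ → ℝ} {a b x0 : ℝ} (hab : a ≤ b)
    (hF : ContinuousOn F (Icc a b)) (hanti : AntitoneOn F (Icc a b)) (ha : 0 ≤ F a) (hb : F b ≤ 0)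
    (hx0 : x0 ∈ Icc a b) :
    ∃ x : ℝ → ℝ, ContinuousOn x (Ici 0) ∧ (∀ t, 0 ≤ t → x t ∈ Icc a b) ∧
      ∀ t, 0 ≤ t → x t = x0 + ∫ s in (0 : ℝ)..t, F (x s) := by
  -- Composing with the projection extends `F` to the line and keeps it continuous and antitone; the
  -- solution is later shown never to leave `[a, b]`.
  let p : ℝ → ℝ := fun z => (projIcc a b hab z : ℝ)
  have hpc : Continuous p := continuous_subtype_val.comp continuous_projIcc
  have hpm : ∀ z, p z ∈ Icc a b := fun z => (projIcc a b hab z).2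
  have hpmono : Monotone p := fun y z h => monotone_projIcc hab h
  have hplip : ∀ y z, |p y - p z| ≤ |y - z| := fun y z => abs_projIcc_sub_projIcc hab
  have hFp : Continuous fun z => F (p z) :=
    hF.comp_continuous hpc hpm
  have hFpanti : Antitone fun z => F (p z) := fun y z h => hanti (hpm y) (hpm z) (hpmono h)
  -- `F` is only continuous, so the contraction argument does not apply to it. Polynomial
  -- approximations are Lipschitz on `[a, b]`, which makes the approximate equations solvable.
  have hq : ∀ n : ℕ, ∃ q : Polynomial ℝ, ∀ z ∈ Icc a b, |q.eval z - F z| < 1 / ((n : ℝ) + 1) :=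
    fun n => exists_polynomial_near_of_continuousOn a b F hF _ (by positivity)
  choose q hq using hq
  have hqc : ∀ n, Continuous fun z => (q n).eval (p z) := fun n => (q n).continuous.comp hpc
  obtain ⟨C, hC⟩ := isCompact_Icc.exists_bound_of_continuousOn hF
  have hqb : ∀ n z, |(q n).eval (p z)| ≤ C + 1 := by
    intro n z
    have h1 := (hq n _ (hpm z)).le
    have h2 : 1 / ((n : ℝ) + 1) ≤ 1 := by
      rw [div_le_one (by positivity)]; linarith [(n.cast_nonneg : (0 : ℝ) ≤ n)]
    have h3 := hC _ (hpm z)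
    rw [Real.norm_eq_abs] at h3
    have := abs_add_le ((q n).eval (p z) - F (p z)) (F (p z))
    rw [sub_add_cancel] at this
    linarith
  have hex : ∀ n, ∃ x : ℝ → ℝ, Continuous x ∧
      ∀ t, 0 ≤ t → x t = x0 + ∫ s in (0 : ℝ)..t, (q n).eval (p (x s)) := by
    intro n
    have hcd : ContDiffOn ℝ 1 (fun z => (q n).eval z) (Icc a b) :=
      ContDiff.contDiffOn (by simpa using (q n).contDiff_aeval (𝕜 := ℝ) (R := ℝ) 1)
    obtain ⟨K, hK⟩ := hcd.exists_lipschitzOnWith (by decide) (convex_Icc _ _) isCompact_Icc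
    refine exists_continuous_eq_add_integral (F := fun _ z => (q n).eval (p z)) (L := K + 1)
      (C := C + 1) (by positivity) (fun u hu => ((hqc n).comp hu).measurable)
      (fun _ z => hqb n z) (fun _ y z => ?_) x0
    have h1 := hK.dist_le_mul _ (hpm y) _ (hpm z)
    rw [Real.dist_eq, Real.dist_eq] at h1
    refine h1.trans ?_
    have := hplip y z
    gcongr
    simp
  choose X hXc hX using hex
  -- Where `X n > X m`, antitonicity of `F` leaves only the two approximation errors in the rate of
  -- the difference. The approximate solutions are thus Cauchy, with no compactness argument.
  have hcomp : ∀ n m t, 0 ≤ t → X n t - X m t ≤ (1 / ((n : ℝ) + 1) + 1 / ((m : ℝ) + 1)) * t := by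
    intro n m t ht
    set ε := 1 / ((n : ℝ) + 1) + 1 / ((m : ℝ) + 1)
    have hi : ∀ k t, IntervalIntegrable (fun s => (q k).eval (p (X k s))) volume 0 t :=
      fun k t => ((hqc k).comp (hXc k)).intervalIntegrable _ _
    have := nonpos_of_eq_add_integral (x := fun t => X n t - X m t - ε * t)
      (φ := fun s => (q n).eval (p (X n s)) - (q m).eval (p (X m s)) - ε) (T := t) (L := 0)
      (x0 := 0) (((hXc n).sub (hXc m)).sub (by fun_prop)).continuousOn
      (((hi n t).sub (hi m t)).sub (by simp)) ?_ le_rfl le_rfl ?_ t ⟨ht, le_rfl⟩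
    · linarith
    · intro r hr
      rw [intervalIntegral.integral_sub ((hi n r).sub (hi m r)) (by simp),
        intervalIntegral.integral_sub (hi n r) (hi m r), intervalIntegral.integral_const]
      simp only [hX n r hr.1, hX m r hr.1, smul_eq_mul]; ring
    · intro s hs hpos
      have hε : 0 ≤ ε := by positivity
      have hlt : X m s ≤ X n s := by nlinarith [hs.1]
      have h1 := (abs_lt.1 (hq n _ (hpm (X n s)))).2
      have h2 := (abs_lt.1 (hq m _ (hpm (X m s)))).1
      have h3 := hFpanti hlt
      simp only [zero_mul] at *
      simp only [ε] at *
      linarith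
  have hlim : ∀ t, 0 ≤ t → ∃ l, Tendsto (fun n => X n t) atTop (𝓝 l) := by
    intro t ht
    refine cauchySeq_tendsto_of_complete ?_
    refine cauchySeq_of_le_tendsto_0 (fun N : ℕ => (1 / ((N : ℝ) + 1) + 1 / ((N : ℝ) + 1)) * t) ?_ ?_
    · intro n m N hn hm
      have e1 : 1 / ((n : ℝ) + 1) ≤ 1 / ((N : ℝ) + 1) := by gcongr
      have e2 : 1 / ((m : ℝ) + 1) ≤ 1 / ((N : ℝ) + 1) := by gcongr
      have h1 := hcomp n m t ht
      have h2 := hcomp m n t ht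
      rw [Real.dist_eq, abs_le]
      constructor <;> nlinarith
    · have := tendsto_one_div_add_atTop_nhds_zero_nat (𝕜 := ℝ)
      simpa using (this.add this).mul_const t
  choose! x hx using hlim
  have hmeas : Measurable (fun s => x (max s 0)) :=
    measurable_of_tendsto_metrizable (f := fun n s => X n (max s 0))
      (fun n => ((hXc n).comp (by fun_prop)).measurable)
      (tendsto_pi_nhds.2 fun s => hx _ (le_max_right _ _))
  have hFb : ∀ z, ‖F (p z)‖ ≤ C + 1 := fun z => (hC _ (hpm z)).trans (by linarith)
  have hint : ∀ r t, IntervalIntegrable (fun s => F (p (x (max s 0)))) volume r t := by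
    intro r t
    refine (intervalIntegrable_const (c := C + 1)).mono_fun'
      (hFp.measurable.comp hmeas).aestronglyMeasurable ?_
    exact ae_of_all _ fun s => hFb _
  have hxeq : ∀ t, 0 ≤ t → x t = x0 + ∫ s in (0 : ℝ)..t, F (p (x (max s 0))) := by
    intro t ht
    have h1 : Tendsto (fun n => ∫ s in (0 : ℝ)..t, (q n).eval (p (X n s))) atTop
        (𝓝 (∫ s in (0 : ℝ)..t, F (p (x (max s 0))))) := by
      refine intervalIntegral.tendsto_integral_filter_of_dominated_convergence (fun _ => C + 1)
        (Eventually.of_forall fun n => ((hqc n).comp (hXc n)).aestronglyMeasurable)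
        (Eventually.of_forall fun n => ae_of_all _ fun s _ => hqb n _) (by simp)
        (ae_of_all _ fun s hs => ?_)
      rw [uIoc_of_le ht] at hs
      rw [max_eq_left hs.1.le]
      have h2 : Tendsto (fun n => F (p (X n s))) atTop (𝓝 (F (p (x s)))) :=
        (hFp.tendsto _).comp (hx s hs.1.le)
      have h3 : Tendsto (fun n => (q n).eval (p (X n s)) - F (p (X n s))) atTop (𝓝 0) :=
        squeeze_zero_norm (fun n => (hq n _ (hpm _)).le)
          (tendsto_one_div_add_atTop_nhds_zero_nat (𝕜 := ℝ))
      simpa using h3.add h2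
    refine tendsto_nhds_unique (hx t ht) ?_
    simp_rw [fun n => hX n t ht]
    exact h1.const_add x0
  have hxc : ContinuousOn x (Ici 0) := by
    have : Continuous fun t => x0 + ∫ s in (0 : ℝ)..t, F (p (x (max s 0))) :=
      continuous_const.add (intervalIntegral.continuous_primitive (fun r t => hint r t) 0)
    exact this.continuousOn.congr fun t ht => hxeq t ht
  -- Below `a` the projected field equals `F a ≥ 0`, so the path cannot go there; the upper end is
  -- symmetric.
  have hlow : ∀ t, 0 ≤ t → a ≤ x t := by
    intro t ht
    have := nonpos_of_eq_add_integral (x := fun t => a - x t)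
      (φ := fun s => - F (p (x (max s 0)))) (T := t) (L := 0) (x0 := a - x0)
      (continuousOn_const.sub (hxc.mono Icc_subset_Ici_self)) (hint 0 t).neg ?_
      (by linarith [hx0.1]) le_rfl ?_ t ⟨ht, le_rfl⟩
    · linarith
    · intro r hr
      rw [intervalIntegral.integral_neg]
      simp only [hxeq r hr.1]; ring
    · intro s hs hpos
      have : p (x s) = a := by
        simp only [p]; rw [projIcc_of_le_left hab (by linarith)]
      rw [max_eq_left hs.1, this]; linarith
  have hupp : ∀ t, 0 ≤ t → x t ≤ b := by
    intro t ht
    have := nonpos_of_eq_add_integral (x := fun t => x t - b)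
      (φ := fun s => F (p (x (max s 0)))) (T := t) (L := 0) (x0 := x0 - b)
      ((hxc.mono Icc_subset_Ici_self).sub continuousOn_const) (hint 0 t) ?_
      (by linarith [hx0.2]) le_rfl ?_ t ⟨ht, le_rfl⟩
    · linarith
    · intro r hr
      simp only [hxeq r hr.1]; ring
    · intro s hs hpos
      have : p (x s) = b := by
        simp only [p]; rw [projIcc_of_right_le hab (by linarith)]
      rw [max_eq_left hs.1, this]; linarith
  refine ⟨x, hxc, fun t ht => ⟨hlow t ht, hupp t ht⟩, fun t ht => ?_⟩
  rw [hxeq t ht]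
  congr 1
  refine intervalIntegral.integral_congr fun s hs => ?_
  rw [uIcc_of_le ht] at hs
  simp only [max_eq_left hs.1, p, projIcc_of_mem hab ⟨hlow s hs.1, hupp s hs.1⟩]

/-! ### Regularity of functions concave in `x` and convex in `1 / x`. -/

/-- An antitone function whose image is an interval is continuous. -/
theorem AntitoneOn.continuousOn_of_ordConnected_image {f : ℝ → ℝ} {s : Set ℝ}
    (hf : AntitoneOn f s) (himg : (f '' s).OrdConnected) : ContinuousOn f s := by
  intro x hx
  refine tendsto_order.2 ⟨fun l hl => ?_, fun l hl => ?_⟩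
  -- If some value is at most `l`, a level between `l` and `f x` is attained at a point to the right
  -- of `x`, and antitonicity gives the bound on everything to the left of that point.
  · by_cases h : ∀ z ∈ s, l < f z
    · exact eventually_nhdsWithin_of_forall h
    push Not at h
    obtain ⟨z, hz, hzl⟩ := h
    obtain ⟨m, hlm, hmx⟩ := exists_between hl
    obtain ⟨c, hc, rfl⟩ := himg.out ⟨z, hz, rfl⟩ ⟨x, hx, rfl⟩ ⟨hzl.trans hlm.le, hmx.le⟩
    have hxc : x < c := by
      by_contra! hcon
      exact absurd (hf hc hx hcon) (not_le.2 hmx)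
    filter_upwards [self_mem_nhdsWithin, mem_nhdsWithin_of_mem_nhds (Iio_mem_nhds hxc)] with y hy hyc
    exact hlm.trans_le (hf hy hc (le_of_lt hyc))
  · by_cases h : ∀ z ∈ s, f z < l
    · exact eventually_nhdsWithin_of_forall h
    push Not at h
    obtain ⟨z, hz, hzl⟩ := h
    obtain ⟨m, hlm, hmx⟩ := exists_between hl
    obtain ⟨c, hc, rfl⟩ := himg.out ⟨x, hx, rfl⟩ ⟨z, hz, rfl⟩ ⟨hlm.le, hmx.le.trans hzl⟩
    have hxc : c < x := by
      by_contra! hcon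
      exact absurd (hf hx hc hcon) (not_le.2 hlm)
    filter_upwards [self_mem_nhdsWithin, mem_nhdsWithin_of_mem_nhds (Ioi_mem_nhds hxc)] with y hy hyc
    exact (hf hc hy (le_of_lt hyc)).trans_lt hmx

section ConcaveConvex

variable {v : ℝ → ℝ} {b M : ℝ}

/-- A function that is concave in `x` and convex in `1 / x` is differentiable. -/
theorem differentiableOn_of_concaveOn_of_convexOn_inv (hb : 0 < b)
    (hconc : ConcaveOn ℝ (Icc 0 b) v) (hmono : MonotoneOn v (Icc 0 b))
    (hlip : ∀ x ∈ Icc 0 b, ∀ y ∈ Icc 0 b, x ≤ y → v y - v x ≤ M * (y - x))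
    (hconv : ConvexOn ℝ (Ici b⁻¹) fun y => v y⁻¹) : DifferentiableOn ℝ v (Icc 0 b) := by
  intro x hx
  have h0m : (0 : ℝ) ∈ Icc 0 b := ⟨le_rfl, hb.le⟩
  have hbm : b ∈ Icc 0 b := ⟨hb.le, le_rfl⟩
  rcases hx.1.eq_or_lt with rfl | hx0
  -- At the end points concavity makes the slopes monotone. The Lipschitz bound keeps them bounded
  -- at `0`, and monotonicity of `v` does so at `b`.
  · have ht : Tendsto (slope v 0) (𝓝[>] 0) (𝓝 (sSup (slope v 0 '' Ioo 0 b))) := by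
      refine AntitoneOn.tendsto_nhdsWithin_Ioo_right (by simpa using hb)
        ((hconc.antitoneOn_slope_gt h0m).mono fun z hz => ⟨Ioo_subset_Icc_self hz, hz.1⟩) ?_
      refine ⟨M, ?_⟩
      rintro _ ⟨z, hz, rfl⟩
      rw [slope_def_field, div_le_iff₀ (by linarith [hz.1])]
      exact hlip 0 h0m z (Ioo_subset_Icc_self hz) hz.1.le
    have hd : HasDerivWithinAt v (sSup (slope v 0 '' Ioo 0 b)) (Ioi 0) 0 := by
      rw [hasDerivWithinAt_iff_tendsto_slope]
      simpa using ht
    exact (hd.Ici_of_Ioi.mono Icc_subset_Ici_self).differentiableWithinAt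
  rcases hx.2.eq_or_lt with rfl | hxb
  · have ht : Tendsto (slope v x) (𝓝[<] x) (𝓝 (sInf (slope v x '' Ioo 0 x))) := by
      refine AntitoneOn.tendsto_nhdsWithin_Ioo_left (by simpa using hb)
        ((hconc.antitoneOn_slope_lt hbm).mono fun z hz => ⟨Ioo_subset_Icc_self hz, hz.2⟩) ?_
      refine ⟨0, ?_⟩
      rintro _ ⟨z, hz, rfl⟩
      rw [slope_comm, slope_def_field]
      exact div_nonneg (sub_nonneg.2 (hmono (Ioo_subset_Icc_self hz) hbm hz.2.le))
        (by linarith [hz.2])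
    have hd : HasDerivWithinAt v (sInf (slope v x '' Ioo 0 x)) (Iio x) x := by
      rw [hasDerivWithinAt_iff_tendsto_slope]
      simpa using ht
    exact (hd.Iic_of_Iio.mono Icc_subset_Iic_self).differentiableWithinAt
  have hint : x⁻¹ ∈ interior (Ici b⁻¹) := by
    rw [interior_Ici]; exact (inv_lt_inv₀ hb hx0).2 hxb
  have hinv : HasDerivAt (fun z : ℝ => z⁻¹) (-(x ^ 2)⁻¹) x := hasDerivAt_inv hx0.ne'
  have hR : HasDerivWithinAt v
      (derivWithin (fun y => v y⁻¹) (Iio x⁻¹) x⁻¹ * -(x ^ 2)⁻¹) (Ioi x) x := by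
    have := (hconv.hasDerivWithinAt_leftDeriv_of_mem_interior hint).comp x
      (hinv.hasDerivWithinAt (s := Ioi x))
      (fun z hz => (inv_lt_inv₀ (hx0.trans hz) hx0).2 hz)
    simpa [Function.comp_def] using this
  have hL : HasDerivWithinAt v
      (derivWithin (fun y => v y⁻¹) (Ioi x⁻¹) x⁻¹ * -(x ^ 2)⁻¹) (Ioo 0 x) x := by
    have := (hconv.hasDerivWithinAt_rightDeriv_of_mem_interior hint).comp x
      (hinv.hasDerivWithinAt (s := Ioo 0 x))
      (fun z hz => (inv_lt_inv₀ hx0 hz.1).2 hz.2)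
    simpa [Function.comp_def] using this
  replace hL := hL.mono_of_mem_nhdsWithin (Ioo_mem_nhdsLT hx0)
  -- Inversion exchanges the two sides. Convexity in `1 / x` gives `l ≤ r` for the one-sided
  -- derivatives at `1 / x`, and concavity in `x` gives `r ≤ l`.
  have hle1 := hconv.leftDeriv_le_rightDeriv_of_mem_interior hint
  have hle2 := hconc.neg.leftDeriv_le_rightDeriv_of_mem_interior
    (x := x) (by rw [interior_Icc]; exact ⟨hx0, hxb⟩)
  rw [hL.neg.derivWithin (uniqueDiffWithinAt_Iio x),
    hR.neg.derivWithin (uniqueDiffWithinAt_Ioi x)] at hle2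
  set l := derivWithin (fun y => v y⁻¹) (Iio x⁻¹) x⁻¹
  set r := derivWithin (fun y => v y⁻¹) (Ioi x⁻¹) x⁻¹
  have hpos : 0 < (x ^ 2)⁻¹ := by positivity
  have hlr : l = r := le_antisymm hle1 (by nlinarith)
  rw [hlr] at hR
  have := hL.Iic_of_Iio.union hR.Ici_of_Ioi
  rw [Iic_union_Ici] at this
  exact (this.mono (subset_univ _)).differentiableWithinAt

/-- A differentiable concave function on an interval is continuously differentiable. -/
theorem ConcaveOn.contDiffOn_one_Icc (hb : 0 < b) (hconc : ConcaveOn ℝ (Icc 0 b) v)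
    (hd : DifferentiableOn ℝ v (Icc 0 b)) : ContDiffOn ℝ 1 v (Icc 0 b) := by
  rw [show (1 : WithTop ℕ∞) = 0 + 1 from rfl, contDiffOn_succ_iff_derivWithin (uniqueDiffOn_Icc hb)]
  refine ⟨hd, by simp, ?_⟩
  rw [contDiffOn_zero]
  -- By Darboux the derivative takes an interval of values; being antitone, it has no jumps.
  exact (hconc.antitoneOn_derivWithin hd).continuousOn_of_ordConnected_image
    (ordConnected_Icc.image_hasDerivWithinAt fun x hx => (hd x hx).hasDerivWithinAt)

/-- If `y ↦ v (1 / y)` is convex, then `x ↦ x² v'(x)` is monotone. -/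
theorem monotoneOn_sq_mul_derivWithin (hb : 0 < b) (hd : DifferentiableOn ℝ v (Icc 0 b))
    (hmono : MonotoneOn v (Icc 0 b)) (hconv : ConvexOn ℝ (Ici b⁻¹) fun y => v y⁻¹) :
    MonotoneOn (fun x => x ^ 2 * derivWithin v (Icc 0 b) x) (Icc 0 b) := by
  have hmaps : MapsTo (fun y : ℝ => y⁻¹) (Ici b⁻¹) (Icc 0 b) := fun y hy => by
    have hy0 : 0 < y := (inv_pos.2 hb).trans_le hy
    exact ⟨(inv_pos.2 hy0).le, inv_le_of_inv_le₀ hb hy⟩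
  -- At `y = 1 / x` this derivative is `-x² v'(x)`; it increases in `y`, so `x² v'(x)` increases in
  -- `x`.
  have hW : ∀ y ∈ Ici b⁻¹, HasDerivWithinAt (fun y => v y⁻¹)
      (derivWithin v (Icc 0 b) y⁻¹ * -(y ^ 2)⁻¹) (Ici b⁻¹) y := fun y hy =>
    ((hd _ (hmaps hy)).hasDerivWithinAt).comp y
      ((hasDerivAt_inv ((inv_pos.2 hb).trans_le hy).ne').hasDerivWithinAt) hmaps
  have hWm := hconv.monotoneOn_derivWithin fun y hy => (hW y hy).differentiableWithinAt
  intro x hx z hz hxz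
  have hnn : ∀ z, 0 ≤ derivWithin v (Icc 0 b) z := fun z => hmono.derivWithin_nonneg
  rcases hx.1.eq_or_lt with rfl | hx0
  · simpa using mul_nonneg (sq_nonneg z) (hnn z)
  have hz0 := hx0.trans_le hxz
  have hxi : x⁻¹ ∈ Ici b⁻¹ := inv_anti₀ hx0 hx.2
  have hzi : z⁻¹ ∈ Ici b⁻¹ := inv_anti₀ hz0 hz.2
  have := hWm hzi hxi (inv_anti₀ hx0 hxz)
  rw [(hW _ hzi).derivWithin (uniqueDiffOn_Ici _ _ hzi),
    (hW _ hxi).derivWithin (uniqueDiffOn_Ici _ _ hxi)] at this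
  simp only [inv_inv, inv_pow] at this
  simp only
  linarith

end ConcaveConvex

/-! ### The controlled Riccati flow. -/

namespace AcqModel

section State

variable {P : AcqModel}

theorem gammaInf_nonneg : 0 ≤ P.gammaInf := by
  unfold gammaInf
  have h : P.lam * P.sig1 ^ 2 ≤
      Real.sqrt (P.lam ^ 2 * P.sig1 ^ 4 + P.sig1 ^ 2 * P.sig2 ^ 2) :=
    Real.le_sqrt_of_sq_le (by nlinarith [sq_nonneg (P.sig1 * P.sig2)])
  linarith

namespace Standing

theorem gmax_pos (hP : P.Standing) : 0 < P.gmax := gammaInf_nonneg.trans_lt hP.gmax_gt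

/-- The choice of `a₂` collapses the weight to `a₃² / (2ρ)`, so the sign of `a₃` plays no role. -/
theorem abar_nonneg (hP : P.Standing) : 0 ≤ P.abar := by
  have h1 := hP.rho_pos
  have h2 : 0 < 2 * P.lam + P.del := by linarith [hP.lam_nonneg, hP.del_pos]
  have : P.abar = P.a3 ^ 2 / (2 * P.rho) := by
    unfold abar a2
    field_simp
    ring
  rw [this]; positivity

theorem hmax_nonneg (hP : P.Standing) : 0 ≤ P.hmax := Function.invFunOn_mem hP.M0_mem

theorem cDeriv_hmax (hP : P.Standing) : P.cDeriv P.hmax = P.M0 := Function.invFunOn_eq hP.M0_mem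

theorem continuousOn_c (hP : P.Standing) : ContinuousOn P.c (Ici 0) := hP.c_contDiff_one.continuousOn

theorem c_le_of_mem (hP : P.Standing) {h : ℝ} (hh : h ∈ Icc 0 P.hmax) : P.c h ≤ P.c P.hmax :=
  hP.c_strictMono.monotoneOn hh.1 hP.hmax_nonneg hh.2

/-- `gammaInf` is the larger root of the uncontrolled quadratic drift, and observation only lowers
the drift. Hence `γ_max` is a barrier for the flow. -/
theorem f_nonpos (hP : P.Standing) {g h : ℝ} (hg : P.gmax ≤ g) (hh : 0 ≤ h) : P.f g h ≤ 0 := by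
  have hs := hP.sig1_pos
  have hg0 : P.gammaInf ≤ g := hP.gmax_gt.le.trans hg
  have h1 : P.lam ^ 2 * P.sig1 ^ 4 + P.sig1 ^ 2 * P.sig2 ^ 2 ≤ (g + P.lam * P.sig1 ^ 2) ^ 2 := by
    have hpos : 0 ≤ g + P.lam * P.sig1 ^ 2 :=
      add_nonneg (gammaInf_nonneg.trans hg0) (mul_nonneg hP.lam_nonneg (sq_nonneg _))
    rw [← Real.sqrt_le_left hpos]
    unfold gammaInf at hg0
    linarith
  have h2 : P.sig2 ^ 2 ≤ (1 / P.sig1) ^ 2 * g ^ 2 + 2 * P.lam * g := by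
    have h3 : (1 / P.sig1) ^ 2 * g ^ 2 + 2 * P.lam * g =
        (g ^ 2 + 2 * P.lam * P.sig1 ^ 2 * g) / P.sig1 ^ 2 := by field_simp
    rw [h3, le_div_iff₀ (by positivity)]
    nlinarith
  unfold f
  nlinarith [mul_nonneg hh (sq_nonneg g)]

/-- The Riccati right-hand side is decreasing in the state. -/
theorem f_anti (hP : P.Standing) {g g' h : ℝ} (hg : 0 ≤ g) (hgg : g ≤ g') (hh : 0 ≤ h) :
    P.f g' h ≤ P.f g h := by
  unfold f
  have h1 : 0 ≤ (1 / P.sig1) ^ 2 + h := by positivity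
  have h2 : g ^ 2 ≤ g' ^ 2 := by gcongr
  nlinarith [mul_le_mul_of_nonneg_left h2 h1, mul_le_mul_of_nonneg_left hgg hP.lam_nonneg]

theorem abs_f_le (hP : P.Standing) {g h : ℝ} (hg : g ∈ Icc 0 P.gmax) (hh : h ∈ Icc 0 P.hmax) :
    |P.f g h| ≤ ((1 / P.sig1) ^ 2 + P.hmax) * P.gmax ^ 2 + 2 * P.lam * P.gmax + P.sig2 ^ 2 := by
  have h1 : 0 ≤ (1 / P.sig1) ^ 2 + h := add_nonneg (by positivity) hh.1
  have h2 : g ^ 2 ≤ P.gmax ^ 2 := pow_le_pow_left₀ hg.1 hg.2 2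
  have h3 : ((1 / P.sig1) ^ 2 + h) * g ^ 2 ≤ ((1 / P.sig1) ^ 2 + P.hmax) * P.gmax ^ 2 :=
    mul_le_mul (by linarith [hh.2]) h2 (sq_nonneg _) (by linarith [hh.2])
  have h4 := mul_le_mul_of_nonneg_left hg.2 hP.lam_nonneg
  have h5 := mul_nonneg hP.lam_nonneg hg.1
  have h6 := mul_nonneg h1 (sq_nonneg g)
  unfold f
  rw [abs_le]
  constructor <;> nlinarith [sq_nonneg P.sig2]

end Standing

/-- Admissibility constrains only the restriction to the half-line; this is the globally measurable
representative. -/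
theorem measurable_comp_max {h : ℝ → ℝ} (hh : h ∈ P.Adm) : Measurable fun t => h (max t 0) :=
  hh.1.comp (g := (Ici (0 : ℝ)).domRestrict h)
    (f := fun t : ℝ => ⟨max t 0, mem_Ici.2 (le_max_right _ _)⟩)
    (Measurable.subtype_mk (by fun_prop))

theorem intervalIntegrable_adm {h : ℝ → ℝ} (hh : h ∈ P.Adm) {a t : ℝ} (ha : 0 ≤ a) (ht : 0 ≤ t) :
    IntervalIntegrable h volume a t := by
  have h1 : IntervalIntegrable (fun s => h (max s 0)) volume a t := by
    refine (intervalIntegrable_const (c := P.hmax)).mono_fun'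
      (measurable_comp_max hh).aestronglyMeasurable (ae_of_all _ fun s => ?_)
    have := hh.2 (max s 0) (le_max_right _ _)
    simpa only [Real.norm_eq_abs, abs_of_nonneg this.1] using this.2
  refine h1.congr fun s hs => ?_
  have : 0 ≤ s := (le_min ha ht).trans (mem_Ioc.1 hs).1.le
  simp only [max_eq_left this]

theorem intervalIntegrable_f {h g : ℝ → ℝ} (hh : h ∈ P.Adm) (hg : ContinuousOn g (Ici 0)) {a t : ℝ}
    (ha : 0 ≤ a) (ht : 0 ≤ t) : IntervalIntegrable (fun s => P.f (g s) (h s)) volume a t := by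
  have hg' : ContinuousOn g (uIcc a t) := hg.mono fun s hs => (le_min ha ht).trans hs.1
  have h1 : IntervalIntegrable (fun s => h s * (-(g s) ^ 2)) volume a t :=
    (intervalIntegrable_adm hh ha ht).mul_continuousOn (hg'.pow 2).neg
  have h2 : IntervalIntegrable
      (fun s => -(1 / P.sig1) ^ 2 * (g s) ^ 2 - 2 * P.lam * g s + P.sig2 ^ 2) volume a t :=
    ContinuousOn.intervalIntegrable (by fun_prop)
  refine (h1.add h2).congr fun s _ => ?_
  simp only [f]; ring

namespace IsState

variable {h g : ℝ → ℝ} {g0 : ℝ}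

theorem apply_zero (hg : P.IsState h g0 g) : g 0 = g0 := by simpa using hg.2 0 le_rfl

theorem nonneg (hP : P.Standing) (hh : h ∈ P.Adm) (hg0 : 0 ≤ g0) (hg : P.IsState h g0 g) :
    ∀ t, 0 ≤ t → 0 ≤ g t := by
  intro t ht
  obtain ⟨B, hB⟩ := isCompact_Icc.exists_bound_of_continuousOn
    (hg.1.mono (Icc_subset_Ici_self : Icc 0 t ⊆ Ici 0))
  have hB0 : 0 ≤ B := (norm_nonneg _).trans (hB 0 ⟨le_rfl, ht⟩)
  have hL : 0 ≤ (1 / P.sig1) ^ 2 + P.hmax := add_nonneg (by positivity) hP.hmax_nonneg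
  have := nonpos_of_eq_add_integral (x := fun t => -g t) (φ := fun s => -P.f (g s) (h s)) (T := t)
    (L := ((1 / P.sig1) ^ 2 + P.hmax) * B) (x0 := -g0) (hg.1.mono Icc_subset_Ici_self).neg
    (intervalIntegrable_f hh hg.1 le_rfl ht).neg
    (fun r hr => by rw [intervalIntegral.integral_neg, hg.2 r hr.1]; ring) (by linarith)
    (by positivity) ?_ t ⟨ht, le_rfl⟩
  · linarith
  · intro s hs hpos
    have hb := (abs_le.1 (hB s hs)).1
    have h1 := (hh.2 s hs.1)
    -- The quadratic term has the unfavourable sign for negative states; the a priori bound `B` on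
    -- the compact interval turns it into a linear one.
    have h2 : (-g s) * (-g s) ≤ B * (-g s) := by
      apply mul_le_mul_of_nonneg_right _ hpos.le
      linarith
    have h3 : ((1 / P.sig1) ^ 2 + h s) * ((-g s) * (-g s)) ≤
        ((1 / P.sig1) ^ 2 + P.hmax) * (B * (-g s)) :=
      mul_le_mul (by linarith [h1.2]) h2 (mul_self_nonneg _) hL
    have h4 := mul_nonneg hP.lam_nonneg hpos.le
    simp only [f]
    nlinarith [sq_nonneg P.sig2]

/-- States depend monotonically on the initial value. -/
theorem le_of_le (hP : P.Standing) (hh : h ∈ P.Adm) {a b : ℝ → ℝ} {a0 b0 : ℝ} (ha0 : 0 ≤ a0)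
    (hab : a0 ≤ b0) (ha : P.IsState h a0 a) (hb : P.IsState h b0 b) :
    ∀ t, 0 ≤ t → a t ≤ b t := by
  intro t ht
  have := nonpos_of_eq_add_integral (x := fun t => a t - b t)
    (φ := fun s => P.f (a s) (h s) - P.f (b s) (h s)) (T := t) (L := 0) (x0 := a0 - b0)
    ((ha.1.sub hb.1).mono Icc_subset_Ici_self)
    ((intervalIntegrable_f hh ha.1 le_rfl ht).sub (intervalIntegrable_f hh hb.1 le_rfl ht))
    (fun r hr => by
      rw [intervalIntegral.integral_sub (intervalIntegrable_f hh ha.1 le_rfl hr.1)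
        (intervalIntegrable_f hh hb.1 le_rfl hr.1), ha.2 r hr.1, hb.2 r hr.1]; ring) (by linarith)
    le_rfl (fun s hs hpos => ?_) t ⟨ht, le_rfl⟩
  · linarith
  · have := hP.f_anti (hb.nonneg hP hh (ha0.trans hab) s hs.1) (by linarith) (hh.2 s hs.1).1
      (g' := a s)
    linarith

/-- The flow does not increase distances between states. -/
theorem sub_le_sub (hP : P.Standing) (hh : h ∈ P.Adm) {a b : ℝ → ℝ} {a0 b0 : ℝ} (ha0 : 0 ≤ a0)
    (hab : a0 ≤ b0) (ha : P.IsState h a0 a) (hb : P.IsState h b0 b) :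
    ∀ t, 0 ≤ t → b t - a t ≤ b0 - a0 := by
  intro t ht
  have := nonpos_of_eq_add_integral (x := fun t => b t - a t - (b0 - a0))
    (φ := fun s => P.f (b s) (h s) - P.f (a s) (h s)) (T := t) (L := 0) (x0 := 0)
    (((hb.1.sub ha.1).sub continuousOn_const).mono Icc_subset_Ici_self)
    ((intervalIntegrable_f hh hb.1 le_rfl ht).sub (intervalIntegrable_f hh ha.1 le_rfl ht))
    (fun r hr => by
      rw [intervalIntegral.integral_sub (intervalIntegrable_f hh hb.1 le_rfl hr.1)
        (intervalIntegrable_f hh ha.1 le_rfl hr.1), ha.2 r hr.1, hb.2 r hr.1]; ring) le_rfl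
    le_rfl (fun s hs hpos => ?_) t ⟨ht, le_rfl⟩
  · linarith
  · have := hP.f_anti (ha.nonneg hP hh ha0 s hs.1) (by linarith) (hh.2 s hs.1).1 (g' := b s)
    linarith

theorem eqOn (hP : P.Standing) (hh : h ∈ P.Adm) {a b : ℝ → ℝ} (hg0 : 0 ≤ g0)
    (ha : P.IsState h g0 a) (hb : P.IsState h g0 b) : EqOn a b (Ici 0) := fun t ht =>
  le_antisymm (ha.le_of_le hP hh hg0 le_rfl hb t ht) (hb.le_of_le hP hh hg0 le_rfl ha t ht)

theorem mem_Icc (hP : P.Standing) (hh : h ∈ P.Adm) (hg0 : g0 ∈ Icc 0 P.gmax)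
    (hg : P.IsState h g0 g) : ∀ t, 0 ≤ t → g t ∈ Icc 0 P.gmax := by
  intro t ht
  refine ⟨hg.nonneg hP hh hg0.1 t ht, ?_⟩
  have := nonpos_of_eq_add_integral (x := fun t => g t - P.gmax) (φ := fun s => P.f (g s) (h s))
    (T := t) (L := 0) (x0 := g0 - P.gmax) ((hg.1.sub continuousOn_const).mono Icc_subset_Ici_self)
    (intervalIntegrable_f hh hg.1 le_rfl ht)
    (fun r hr => by simp only [hg.2 r hr.1]; ring) (by linarith [hg0.2]) le_rfl
    (fun s hs hpos => ?_) t ⟨ht, le_rfl⟩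
  · linarith
  · have := hP.f_nonpos (g := g s) (by linarith) (hh.2 s hs.1).1
    linarith

/-- The flow is concave in the initial value. -/
theorem concave (hP : P.Standing) (hh : h ∈ P.Adm) {a b : ℝ → ℝ} {a0 b0 p q : ℝ} (ha0 : 0 ≤ a0)
    (hb0 : 0 ≤ b0) (hp : 0 ≤ p) (hq : 0 ≤ q) (hpq : p + q = 1) (ha : P.IsState h a0 a)
    (hb : P.IsState h b0 b) (hg : P.IsState h (p * a0 + q * b0) g) :
    ∀ t, 0 ≤ t → p * a t + q * b t ≤ g t := by
  intro t ht
  have hi : ∀ {g : ℝ → ℝ}, ContinuousOn g (Ici 0) → ∀ r, 0 ≤ r →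
      IntervalIntegrable (fun s => P.f (g s) (h s)) volume 0 r :=
    fun hg r hr => intervalIntegrable_f hh hg le_rfl hr
  have := nonpos_of_eq_add_integral (x := fun t => p * a t + q * b t - g t)
    (φ := fun s => p * P.f (a s) (h s) + q * P.f (b s) (h s) - P.f (g s) (h s)) (T := t) (L := 0)
    (x0 := 0)
    ((((continuousOn_const.mul ha.1).add (continuousOn_const.mul hb.1)).sub hg.1).mono
      Icc_subset_Ici_self)
    ((((hi ha.1 t ht).const_mul p).add ((hi hb.1 t ht).const_mul q)).sub (hi hg.1 t ht))
    (fun r hr => by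
      rw [intervalIntegral.integral_sub (((hi ha.1 r hr.1).const_mul p).add
        ((hi hb.1 r hr.1).const_mul q)) (hi hg.1 r hr.1), intervalIntegral.integral_add
        ((hi ha.1 r hr.1).const_mul p) ((hi hb.1 r hr.1).const_mul q),
        intervalIntegral.integral_const_mul, intervalIntegral.integral_const_mul,
        ha.2 r hr.1, hb.2 r hr.1, hg.2 r hr.1]; ring) le_rfl
    le_rfl (fun s hs hpos => ?_) t ⟨ht, le_rfl⟩
  · linarith
  · have h1 := (hh.2 s hs.1).1
    have h2 := hP.f_anti (hg.nonneg hP hh (by positivity) s hs.1) (by linarith) h1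
      (g' := p * a s + q * b s)
    -- Concavity of the field in the state; with its monotonicity it shows that the excess `p a + q
    -- b - g` does not grow where it is positive.
    have h3 : p * P.f (a s) (h s) + q * P.f (b s) (h s) ≤ P.f (p * a s + q * b s) (h s) := by
      have hc : 0 ≤ (1 / P.sig1) ^ 2 + h s := by positivity
      have hq' : q = 1 - p := by linarith
      subst hq'
      have := mul_nonneg hc (mul_nonneg (mul_nonneg hp hq) (sq_nonneg (a s - b s)))
      simp only [f]
      nlinarith
    linarith

theorem abs_sub_le (hP : P.Standing) (hh : h ∈ P.Adm) (hg0 : g0 ∈ Icc 0 P.gmax)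
    (hg : P.IsState h g0 g) {t : ℝ} (ht : 0 ≤ t) : |g t - g0| ≤
      (((1 / P.sig1) ^ 2 + P.hmax) * P.gmax ^ 2 + 2 * P.lam * P.gmax + P.sig2 ^ 2) * t := by
  rw [hg.2 t ht, add_sub_cancel_left, ← Real.norm_eq_abs]
  refine (intervalIntegral.norm_integral_le_of_norm_le_const fun s hs => ?_).trans_eq
    (by rw [sub_zero, abs_of_nonneg ht])
  rw [uIoc_of_le ht] at hs
  exact hP.abs_f_le (hg.mem_Icc hP hh hg0 s hs.1.le) (hh.2 s hs.1.le)

/-- Exponential lower bound for the state. -/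
theorem exp_le (hP : P.Standing) (hh : h ∈ P.Adm) (hg0 : g0 ∈ Icc 0 P.gmax)
    (hg : P.IsState h g0 g) {t : ℝ} (ht : 0 ≤ t) :
    g0 * Real.exp (-(((1 / P.sig1) ^ 2 + P.hmax) * P.gmax + 2 * P.lam) * t) ≤ g t := by
  -- Chosen so that `f(γ,h) + K γ ≥ 0` for admissible `γ` and `h`, which makes `exp (K t) γ_t`
  -- nondecreasing.
  set K := ((1 / P.sig1) ^ 2 + P.hmax) * P.gmax + 2 * P.lam with hK
  have hs0 : 0 ≤ (1 / P.sig1) ^ 2 := by positivity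
  have hK0 : 0 ≤ K := add_nonneg (mul_nonneg (add_nonneg hs0 hP.hmax_nonneg) hP.gmax_pos.le)
    (by linarith [hP.lam_nonneg])
  have hid := exp_mul_comp_eq_add_integral (g := g) (φ := fun s => P.f (g s) (h s)) (w := fun z => z)
    (w' := fun _ => 1) (a := 0) (b := P.gmax) (C' := 1) (-K) ht
    (intervalIntegrable_f hh hg.1 le_rfl ht)
    (fun s hs => hP.abs_f_le (hg.mem_Icc hP hh hg0 s hs.1) (hh.2 s hs.1))
    (fun s hs => hg.2 s hs.1) (fun s hs => hg.mem_Icc hP hh hg0 s hs.1)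
    (fun z _ => hasDerivWithinAt_id z _) (by simp)
  have hnn : 0 ≤ ∫ s in (0 : ℝ)..t, Real.exp (- -K * s) * (1 * P.f (g s) (h s) - -K * g s) := by
    refine intervalIntegral.integral_nonneg ht fun s hs => mul_nonneg (Real.exp_pos _).le ?_
    have h1 := hg.mem_Icc hP hh hg0 s hs.1
    have h2 := hh.2 s hs.1
    have h3 : ((1 / P.sig1) ^ 2 + h s) * g s ≤ ((1 / P.sig1) ^ 2 + P.hmax) * P.gmax :=
      mul_le_mul (by linarith [h2.2]) h1.2 h1.1 (add_nonneg hs0 hP.hmax_nonneg)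
    have h4 := mul_le_mul_of_nonneg_right h3 h1.1
    simp only [f, hK]
    nlinarith [sq_nonneg P.sig2]
  have h5 : g0 ≤ Real.exp (- -K * t) * g t := by linarith
  have h6 : Real.exp (-K * t) * Real.exp (- -K * t) = 1 := by rw [← Real.exp_add]; simp
  calc g0 * Real.exp (-K * t) = Real.exp (-K * t) * g0 := mul_comm _ _
    _ ≤ Real.exp (-K * t) * (Real.exp (- -K * t) * g t) := by gcongr
    _ = g t := by rw [← mul_assoc, h6, one_mul]

theorem pos (hP : P.Standing) (hh : h ∈ P.Adm) (hg0 : g0 ∈ Ioc 0 P.gmax)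
    (hg : P.IsState h g0 g) {t : ℝ} (ht : 0 ≤ t) : 0 < g t :=
  (mul_pos hg0.1 (Real.exp_pos _)).trans_le (hg.exp_le hP hh (Ioc_subset_Icc_self hg0) ht)

/-- The equation of the precision `1 / γ`. -/
theorem inv_eq (hP : P.Standing) (hh : h ∈ P.Adm) (hg0 : g0 ∈ Ioc 0 P.gmax)
    (hg : P.IsState h g0 g) {t : ℝ} (ht : 0 ≤ t) :
    (g t)⁻¹ = g0⁻¹ + ∫ s in (0 : ℝ)..t,
      ((1 / P.sig1) ^ 2 + h s + 2 * P.lam * (g s)⁻¹ - P.sig2 ^ 2 * (g s)⁻¹ ^ 2) := by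
  have hg0' := Ioc_subset_Icc_self hg0
  set K := ((1 / P.sig1) ^ 2 + P.hmax) * P.gmax + 2 * P.lam with hK
  have hs0 : 0 ≤ (1 / P.sig1) ^ 2 := by positivity
  have hK0 : 0 ≤ K := add_nonneg (mul_nonneg (add_nonneg hs0 hP.hmax_nonneg) hP.gmax_pos.le)
    (by linarith [hP.lam_nonneg])
  -- A positive lower bound for the state on `[0, t]`, so that `z ↦ 1 / z` has bounded derivative on
  -- the range; the chain rule is used with discount zero.
  set m := g0 * Real.exp (-K * t)
  have hm : 0 < m := mul_pos hg0.1 (Real.exp_pos _)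
  have hid := exp_mul_comp_eq_add_integral (g := g) (φ := fun s => P.f (g s) (h s))
    (w := fun z => z⁻¹) (w' := fun z => -(z ^ 2)⁻¹) (a := m) (b := P.gmax) (C' := (m ^ 2)⁻¹) 0 ht
    (intervalIntegrable_f hh hg.1 le_rfl ht)
    (fun s hs => hP.abs_f_le (hg.mem_Icc hP hh hg0' s hs.1) (hh.2 s hs.1))
    (fun s hs => hg.2 s hs.1)
    (fun s hs => ⟨?_, (hg.mem_Icc hP hh hg0' s hs.1).2⟩)
    (fun z hz => (hasDerivAt_inv (hm.trans_le hz.1).ne').hasDerivWithinAt) ?_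
  · simp only [neg_zero, zero_mul, Real.exp_zero, one_mul, sub_zero] at hid
    rw [hid]
    congr 1
    refine intervalIntegral.integral_congr fun s hs => ?_
    rw [uIcc_of_le ht] at hs
    have := hg.pos hP hh hg0 hs.1
    simp only [f]
    field_simp
    ring
  · refine le_trans ?_ (hg.exp_le hP hh hg0' hs.1)
    rw [← hK]
    simp only [m]
    have := hs.2
    have := hg0.1
    gcongr 2
    nlinarith
  · intro z hz
    rw [abs_neg, abs_of_nonneg (by positivity)]
    have := hz.1
    gcongr

/-- Mixing two controls yields at least the mixed precision. -/
theorem mix_inv_le (hP : P.Standing) {h₁ h₂ a b : ℝ → ℝ} (hh : h ∈ P.Adm) (hh₁ : h₁ ∈ P.Adm)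
    (hh₂ : h₂ ∈ P.Adm) {a0 b0 p q : ℝ} (ha0 : a0 ∈ Ioc 0 P.gmax) (hb0 : b0 ∈ Ioc 0 P.gmax)
    (hg0 : g0 ∈ Ioc 0 P.gmax) (hp : 0 ≤ p) (hq : 0 ≤ q) (hpq : p + q = 1)
    (hmix : ∀ t, h t = p * h₁ t + q * h₂ t) (hg0mix : g0⁻¹ = p * a0⁻¹ + q * b0⁻¹)
    (ha : P.IsState h₁ a0 a) (hb : P.IsState h₂ b0 b) (hg : P.IsState h g0 g) :
    ∀ t, 0 ≤ t → p * (a t)⁻¹ + q * (b t)⁻¹ ≤ (g t)⁻¹ := by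
  intro t ht
  let ψ : (ℝ → ℝ) → (ℝ → ℝ) → ℝ → ℝ := fun h g s =>
    (1 / P.sig1) ^ 2 + h s + 2 * P.lam * (g s)⁻¹ - P.sig2 ^ 2 * (g s)⁻¹ ^ 2
  have hci : ∀ {h g : ℝ → ℝ} {g0 : ℝ}, h ∈ P.Adm → g0 ∈ Ioc 0 P.gmax → P.IsState h g0 g →
      ContinuousOn (fun s => (g s)⁻¹) (Ici 0) := fun hh hg0 hg =>
    hg.1.inv₀ fun s hs => (hg.pos hP hh hg0 hs).ne'
  have hi : ∀ {h g : ℝ → ℝ} {g0 : ℝ}, h ∈ P.Adm → g0 ∈ Ioc 0 P.gmax → P.IsState h g0 g →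
      ∀ r, 0 ≤ r → IntervalIntegrable (ψ h g) volume 0 r := by
    intro h g g0 hh hg0 hg r hr
    have h1 : ContinuousOn (fun s => (g s)⁻¹) (uIcc 0 r) :=
      (hci hh hg0 hg).mono (by rw [uIcc_of_le hr]; exact Icc_subset_Ici_self)
    have h2 : IntervalIntegrable (fun s => (1 / P.sig1) ^ 2 + 2 * P.lam * (g s)⁻¹
        - P.sig2 ^ 2 * (g s)⁻¹ ^ 2) volume 0 r := ContinuousOn.intervalIntegrable (by fun_prop)
    refine ((intervalIntegrable_adm hh le_rfl hr).add h2).congr fun s _ => ?_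
    simp only [ψ]; ring
  -- The control cancels by affinity. Where the mixed precision exceeds that of `g`, convexity of
  -- the square makes the `sig2` contribution nonpositive, leaving growth at rate at most `2λ`.
  have := nonpos_of_eq_add_integral (x := fun t => p * (a t)⁻¹ + q * (b t)⁻¹ - (g t)⁻¹)
    (φ := fun s => p * ψ h₁ a s + q * ψ h₂ b s - ψ h g s) (T := t) (L := 2 * P.lam)
    (x0 := 0)
    ((((continuousOn_const.mul (hci hh₁ ha0 ha)).add
      (continuousOn_const.mul (hci hh₂ hb0 hb))).sub (hci hh hg0 hg)).mono Icc_subset_Ici_self)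
    ((((hi hh₁ ha0 ha t ht).const_mul p).add ((hi hh₂ hb0 hb t ht).const_mul q)).sub
      (hi hh hg0 hg t ht))
    (fun r hr => by
      rw [intervalIntegral.integral_sub (((hi hh₁ ha0 ha r hr.1).const_mul p).add
        ((hi hh₂ hb0 hb r hr.1).const_mul q)) (hi hh hg0 hg r hr.1), intervalIntegral.integral_add
        ((hi hh₁ ha0 ha r hr.1).const_mul p) ((hi hh₂ hb0 hb r hr.1).const_mul q),
        intervalIntegral.integral_const_mul, intervalIntegral.integral_const_mul,
        ha.inv_eq hP hh₁ ha0 hr.1, hb.inv_eq hP hh₂ hb0 hr.1, hg.inv_eq hP hh hg0 hr.1,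
        hg0mix]; ring) le_rfl
    (by linarith [hP.lam_nonneg]) (fun s hs hpos => ?_) t ⟨ht, le_rfl⟩
  · linarith
  · have ya := inv_pos.2 (ha.pos hP hh₁ ha0 hs.1)
    have yb := inv_pos.2 (hb.pos hP hh₂ hb0 hs.1)
    have yg := inv_pos.2 (hg.pos hP hh hg0 hs.1)
    simp only [ψ, hmix s]
    set y1 := (a s)⁻¹
    set y2 := (b s)⁻¹
    set y := (g s)⁻¹
    have hq' : q = 1 - p := by linarith
    subst hq'
    have e1 : y ^ 2 ≤ (p * y1 + (1 - p) * y2) ^ 2 := pow_le_pow_left₀ yg.le (by linarith) 2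
    have e2 := mul_nonneg (mul_nonneg hp hq) (sq_nonneg (y1 - y2))
    have e3 : 0 ≤ P.sig2 ^ 2 * (p * y1 ^ 2 + (1 - p) * y2 ^ 2 - y ^ 2) :=
      mul_nonneg (sq_nonneg _) (by nlinarith)
    nlinarith

/-- The mixed control yields a state below the mixture of the states. -/
theorem le_mix (hP : P.Standing) {h₁ h₂ a b : ℝ → ℝ} (hh : h ∈ P.Adm) (hh₁ : h₁ ∈ P.Adm)
    (hh₂ : h₂ ∈ P.Adm) {a0 b0 p q : ℝ} (ha0 : a0 ∈ Ioc 0 P.gmax) (hb0 : b0 ∈ Ioc 0 P.gmax)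
    (hg0 : g0 ∈ Ioc 0 P.gmax) (hp : 0 ≤ p) (hq : 0 ≤ q) (hpq : p + q = 1)
    (hmix : ∀ t, h t = p * h₁ t + q * h₂ t) (hg0mix : g0⁻¹ = p * a0⁻¹ + q * b0⁻¹)
    (ha : P.IsState h₁ a0 a) (hb : P.IsState h₂ b0 b) (hg : P.IsState h g0 g) {t : ℝ}
    (ht : 0 ≤ t) : g t ≤ p * a t + q * b t := by
  have h1 := mix_inv_le hP hh hh₁ hh₂ ha0 hb0 hg0 hp hq hpq hmix hg0mix ha hb hg t ht
  have pa := ha.pos hP hh₁ ha0 ht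
  have pb := hb.pos hP hh₂ hb0 ht
  have pg := hg.pos hP hh hg0 ht
  -- The weighted harmonic mean is at most the weighted arithmetic mean.
  have h2 : 1 ≤ (p * (a t)⁻¹ + q * (b t)⁻¹) * (p * a t + q * b t) := by
    have h3 : (p * (a t)⁻¹ + q * (b t)⁻¹) * (p * a t + q * b t) =
        (p + q) ^ 2 + p * q * (a t - b t) ^ 2 / (a t * b t) := by
      field_simp; ring
    rw [h3, hpq]
    have : 0 ≤ p * q * (a t - b t) ^ 2 / (a t * b t) := by positivity
    linarith
  have h4 : 1 ≤ (g t)⁻¹ * (p * a t + q * b t) :=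
    h2.trans (mul_le_mul_of_nonneg_right h1 (by positivity))
  rwa [inv_mul_eq_div, one_le_div pg] at h4

end IsState

/-- Existence of the state. -/
theorem exists_isState (hP : P.Standing) {h : ℝ → ℝ} (hh : h ∈ P.Adm) {g0 : ℝ}
    (hg0 : g0 ∈ Icc 0 P.gmax) : ∃ g, P.IsState h g0 g := by
  have hab := hP.gmax_pos.le
  let p : ℝ → ℝ := fun z => (projIcc 0 P.gmax hab z : ℝ)
  have hpc : Continuous p := continuous_subtype_val.comp continuous_projIcc
  have hpm : ∀ z, p z ∈ Icc 0 P.gmax := fun z => (projIcc 0 P.gmax hab z).2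
  have hplip : ∀ y z, |p y - p z| ≤ |y - z| := fun y z => abs_projIcc_sub_projIcc hab
  have hm := measurable_comp_max hh
  have hhm : ∀ s, h (max s 0) ∈ Icc 0 P.hmax := fun s => hh.2 _ (le_max_right _ _)
  have hs0 : 0 ≤ (1 / P.sig1) ^ 2 := by positivity
  -- Lipschitz constant of the field with the state projected to `[0, γ_max]`; the added `1` ensures
  -- `L > 0`.
  set L := ((1 / P.sig1) ^ 2 + P.hmax) * (2 * P.gmax) + 2 * P.lam + 1
  have hL : 0 < L := by
    have := mul_nonneg (add_nonneg hs0 hP.hmax_nonneg) (mul_nonneg zero_le_two hab)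
    have := hP.lam_nonneg
    positivity
  have hmeas : ∀ u : ℝ → ℝ, Continuous u → Measurable fun s => P.f (p (u s)) (h (max s 0)) := by
    intro u hu
    have : Measurable (fun s => p (u s)) := (hpc.comp hu).measurable
    simp only [f]
    exact ((((hm.const_add _).neg.mul (this.pow_const 2)).sub (this.const_mul _)).add_const _)
  have hlip : ∀ s y z, |P.f (p y) (h (max s 0)) - P.f (p z) (h (max s 0))| ≤ L * |y - z| := by
    intro s y z
    have h1 := hpm y
    have h2 := hpm z
    have h3 := hhm s
    have h4 : P.f (p y) (h (max s 0)) - P.f (p z) (h (max s 0)) =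
        -(((1 / P.sig1) ^ 2 + h (max s 0)) * (p y + p z) + 2 * P.lam) * (p y - p z) := by
      simp only [f]; ring
    have h5 : ((1 / P.sig1) ^ 2 + h (max s 0)) * (p y + p z) ≤
        ((1 / P.sig1) ^ 2 + P.hmax) * (2 * P.gmax) :=
      mul_le_mul (by linarith [h3.2]) (by linarith [h1.2, h2.2]) (by linarith [h1.1, h2.1])
        (add_nonneg hs0 hP.hmax_nonneg)
    have h6 := mul_nonneg (add_nonneg hs0 h3.1) (add_nonneg h1.1 h2.1)
    rw [h4, abs_mul, abs_neg, abs_of_nonneg (by linarith [hP.lam_nonneg])]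
    exact mul_le_mul (by simp only [L]; linarith) (hplip y z) (abs_nonneg _) hL.le
  obtain ⟨g, hgc, hg⟩ := exists_continuous_eq_add_integral
    (F := fun s z => P.f (p z) (h (max s 0))) hL hmeas
    (fun s z => hP.abs_f_le (hpm z) (hhm s)) hlip g0
  have hi : ∀ r t, IntervalIntegrable (fun s => P.f (p (g s)) (h (max s 0))) volume r t := by
    intro r t
    refine (intervalIntegrable_const (c := ((1 / P.sig1) ^ 2 + P.hmax) * P.gmax ^ 2
      + 2 * P.lam * P.gmax + P.sig2 ^ 2)).mono_fun' ?_
      (ae_of_all _ fun s => hP.abs_f_le (hpm _) (hhm s))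
    have : Measurable (fun s => p (g s)) := (hpc.comp hgc).measurable
    simp only [f]
    exact ((((hm.const_add _).neg.mul (this.pow_const 2)).sub (this.const_mul _)).add_const
      _).aestronglyMeasurable
  have hlow : ∀ t, 0 ≤ t → 0 ≤ g t := by
    intro t ht
    have := nonpos_of_eq_add_integral (x := fun t => -g t)
      (φ := fun s => -P.f (p (g s)) (h (max s 0))) (T := t) (L := 0) (x0 := -g0)
      hgc.neg.continuousOn (hi 0 t).neg
      (fun r hr => by rw [intervalIntegral.integral_neg, hg r hr.1]; ring)
      (by linarith [hg0.1]) le_rfl (fun s hs hpos => ?_) t ⟨ht, le_rfl⟩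
    · linarith
    · have : p (g s) = 0 := by
        simp only [p]; rw [projIcc_of_le_left hab (by linarith)]
      rw [this]; simp only [f]; nlinarith [sq_nonneg P.sig2]
  have hupp : ∀ t, 0 ≤ t → g t ≤ P.gmax := by
    intro t ht
    have := nonpos_of_eq_add_integral (x := fun t => g t - P.gmax)
      (φ := fun s => P.f (p (g s)) (h (max s 0))) (T := t) (L := 0) (x0 := g0 - P.gmax)
      (hgc.sub continuous_const).continuousOn (hi 0 t)
      (fun r hr => by rw [hg r hr.1]; ring)
      (by linarith [hg0.2]) le_rfl (fun s hs hpos => ?_) t ⟨ht, le_rfl⟩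
    · linarith
    · have : p (g s) = P.gmax := by
        simp only [p]; rw [projIcc_of_right_le hab (by linarith)]
      rw [this, zero_mul]; exact hP.f_nonpos le_rfl (hhm s).1
  refine ⟨g, hgc.continuousOn, fun t ht => ?_⟩
  rw [hg t ht]
  congr 1
  refine intervalIntegral.integral_congr fun s hs => ?_
  rw [uIcc_of_le ht] at hs
  simp only [max_eq_left hs.1, p, projIcc_of_mem hab ⟨hlow s hs.1, hupp s hs.1⟩]

theorem isState_state (hP : P.Standing) {h : ℝ → ℝ} (hh : h ∈ P.Adm) {g0 : ℝ}
    (hg0 : g0 ∈ Icc 0 P.gmax) : P.IsState h g0 (P.state h g0) :=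
  Classical.epsilon_spec (exists_isState hP hh hg0)

end State

end AcqModel

/-! ### Shape and regularity of the value function. -/

namespace AcqModel

section Value

variable {P : AcqModel}

namespace Standing

theorem integrableOn_exp (hP : P.Standing) :
    IntegrableOn (fun t => Real.exp (-P.del * t)) (Ioi 0) :=
  exp_neg_integrableOn_Ioi 0 hP.del_pos

theorem integral_exp (hP : P.Standing) :
    ∫ t in Ioi (0 : ℝ), Real.exp (-P.del * t) = 1 / P.del := by
  rw [integral_exp_mul_Ioi (by linarith [hP.del_pos])]
  simp [neg_div_neg_eq]

theorem integrableOn_exp_mul (hP : P.Standing) {φ : ℝ → ℝ} {C : ℝ}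
    (hm : AEStronglyMeasurable φ (volume.restrict (Ioi 0))) (hb : ∀ t, 0 ≤ t → |φ t| ≤ C) :
    IntegrableOn (fun t => Real.exp (-P.del * t) * φ t) (Ioi 0) := by
  refine hP.integrableOn_exp.mul_bdd (c := C) hm ?_
  filter_upwards [ae_restrict_mem measurableSet_Ioi] with t ht using hb t (le_of_lt ht)

end Standing

theorem aestronglyMeasurable_adm {h : ℝ → ℝ} (hh : h ∈ P.Adm) :
    AEStronglyMeasurable h (volume.restrict (Ioi 0)) := by
  refine (measurable_comp_max hh).aestronglyMeasurable.congr ?_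
  filter_upwards [ae_restrict_mem measurableSet_Ioi] with t ht
  simp only [max_eq_left (le_of_lt (mem_Ioi.1 ht))]

theorem aestronglyMeasurable_c (hP : P.Standing) {h : ℝ → ℝ} (hh : h ∈ P.Adm) :
    AEStronglyMeasurable (fun t => P.c (h t)) (volume.restrict (Ioi 0)) := by
  have hc : Continuous fun x => P.c (max x 0) :=
    hP.continuousOn_c.comp_continuous (by fun_prop) fun x => mem_Ici.2 (le_max_right x 0)
  refine (hc.comp_aestronglyMeasurable (aestronglyMeasurable_adm hh)).congr ?_
  filter_upwards [ae_restrict_mem measurableSet_Ioi] with t ht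
  simp only [max_eq_left (hh.2 t (le_of_lt ht)).1]

theorem aestronglyMeasurable_of_continuousOn {g : ℝ → ℝ} (hg : ContinuousOn g (Ici 0)) :
    AEStronglyMeasurable g (volume.restrict (Ioi 0)) :=
  (hg.mono Ioi_subset_Ici_self).aestronglyMeasurable measurableSet_Ioi

theorem aestronglyMeasurable_k (hP : P.Standing) {h g : ℝ → ℝ} (hh : h ∈ P.Adm)
    (hg : ContinuousOn g (Ici 0)) :
    AEStronglyMeasurable (fun t => P.k (g t) (h t)) (volume.restrict (Ioi 0)) :=
  ((aestronglyMeasurable_of_continuousOn hg).const_mul _).add (aestronglyMeasurable_c hP hh)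

theorem k_nonneg (hP : P.Standing) {g h : ℝ} (hg : 0 ≤ g) (hh : 0 ≤ h) : 0 ≤ P.k g h :=
  add_nonneg (mul_nonneg hP.abar_nonneg hg) (hP.c_nonneg h hh)

theorem k_le (hP : P.Standing) {g h : ℝ} (hg : g ∈ Icc 0 P.gmax) (hh : h ∈ Icc 0 P.hmax) :
    P.k g h ≤ P.k P.gmax P.hmax :=
  add_le_add (mul_le_mul_of_nonneg_left hg.2 hP.abar_nonneg) (hP.c_le_of_mem hh)

theorem IsState.integrableOn_k (hP : P.Standing) {h g : ℝ → ℝ} {g0 : ℝ} (hh : h ∈ P.Adm)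
    (hg0 : g0 ∈ Icc 0 P.gmax) (hg : P.IsState h g0 g) :
    IntegrableOn (fun t => Real.exp (-P.del * t) * P.k (g t) (h t)) (Ioi 0) := by
  refine hP.integrableOn_exp_mul (C := P.k P.gmax P.hmax) (aestronglyMeasurable_k hP hh hg.1)
    fun t ht => ?_
  have h1 := hg.mem_Icc hP hh hg0 t ht
  rw [abs_of_nonneg (k_nonneg hP h1.1 (hh.2 t ht).1)]
  exact k_le hP h1 (hh.2 t ht)

theorem IsState.cost_eq (hP : P.Standing) {h g : ℝ → ℝ} {g0 : ℝ} (hh : h ∈ P.Adm)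
    (hg0 : g0 ∈ Icc 0 P.gmax) (hg : P.IsState h g0 g) :
    P.cost h g0 = ∫ t in Ioi (0 : ℝ), Real.exp (-P.del * t) * P.k (g t) (h t) := by
  refine setIntegral_congr_fun measurableSet_Ioi fun t ht => ?_
  simp only [hg.eqOn hP hh hg0.1 (isState_state hP hh hg0) (le_of_lt (mem_Ioi.1 ht))]

theorem cost_nonneg (hP : P.Standing) {h : ℝ → ℝ} {g0 : ℝ} (hh : h ∈ P.Adm)
    (hg0 : g0 ∈ Icc 0 P.gmax) : 0 ≤ P.cost h g0 :=
  setIntegral_nonneg measurableSet_Ioi fun t ht => mul_nonneg (Real.exp_pos _).le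
    (k_nonneg hP ((isState_state hP hh hg0).nonneg hP hh hg0.1 t (le_of_lt ht))
      (hh.2 t (le_of_lt ht)).1)

theorem bddBelow_cost (hP : P.Standing) {g0 : ℝ} (hg0 : g0 ∈ Icc 0 P.gmax) :
    BddBelow ((fun h => P.cost h g0) '' P.Adm) := by
  refine ⟨0, ?_⟩
  rintro _ ⟨h, hh, rfl⟩
  exact cost_nonneg hP hh hg0

theorem value_le_cost (hP : P.Standing) {h : ℝ → ℝ} {g0 : ℝ} (hh : h ∈ P.Adm)
    (hg0 : g0 ∈ Icc 0 P.gmax) : P.value g0 ≤ P.cost h g0 :=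
  csInf_le (bddBelow_cost hP hg0) ⟨h, hh, rfl⟩

theorem const_mem_adm {h : ℝ} (hh : h ∈ Icc 0 P.hmax) : (fun _ => h) ∈ P.Adm :=
  ⟨measurable_const, fun _ _ => hh⟩

theorem adm_nonempty (hP : P.Standing) : P.Adm.Nonempty :=
  ⟨_, const_mem_adm ⟨le_rfl, hP.hmax_nonneg⟩⟩

theorem le_value (hP : P.Standing) {x g0 : ℝ} (hx : ∀ h ∈ P.Adm, x ≤ P.cost h g0) :
    x ≤ P.value g0 := by
  refine le_csInf ((adm_nonempty hP).image _) ?_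
  rintro _ ⟨h, hh, rfl⟩
  exact hx h hh

theorem exists_cost_lt (hP : P.Standing) (g0 : ℝ) {ε : ℝ} (hε : 0 < ε) :
    ∃ h ∈ P.Adm, P.cost h g0 < P.value g0 + ε := by
  obtain ⟨_, ⟨h, hh, rfl⟩, hlt⟩ := exists_lt_of_csInf_lt ((adm_nonempty hP).image _)
    (lt_add_of_pos_right (P.value g0) hε)
  exact ⟨h, hh, hlt⟩

theorem le_mix_value (hP : P.Standing) {x p q a b : ℝ} (hp : 0 ≤ p) (hq : 0 ≤ q)
    (hx : ∀ h₁ ∈ P.Adm, ∀ h₂ ∈ P.Adm, x ≤ p * P.cost h₁ a + q * P.cost h₂ b) :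
    x ≤ p * P.value a + q * P.value b := by
  refine le_of_forall_pos_le_add fun ε hε => ?_
  have hε' : 0 < ε / (p + q + 1) := by positivity
  obtain ⟨h₁, hh₁, hlt₁⟩ := exists_cost_lt hP a hε'
  obtain ⟨h₂, hh₂, hlt₂⟩ := exists_cost_lt hP b hε'
  have h3 := hx h₁ hh₁ h₂ hh₂
  have h4 := mul_le_mul_of_nonneg_left hlt₁.le hp
  have h5 := mul_le_mul_of_nonneg_left hlt₂.le hq
  have h6 : (p + q) * (ε / (p + q + 1)) ≤ ε := by
    rw [← mul_div_assoc, div_le_iff₀ (by positivity)]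
    nlinarith
  nlinarith

theorem cost_mono (hP : P.Standing) {h : ℝ → ℝ} {a b : ℝ} (hh : h ∈ P.Adm)
    (ha : a ∈ Icc 0 P.gmax) (hb : b ∈ Icc 0 P.gmax) (hab : a ≤ b) : P.cost h a ≤ P.cost h b := by
  have sa := isState_state hP hh ha
  have sb := isState_state hP hh hb
  refine setIntegral_mono_on (sa.integrableOn_k hP hh ha) (sb.integrableOn_k hP hh hb)
    measurableSet_Ioi fun t ht => mul_le_mul_of_nonneg_left ?_ (Real.exp_pos _).le
  exact add_le_add_left (mul_le_mul_of_nonneg_left (sa.le_of_le hP hh ha.1 hab sb t (le_of_lt ht))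
    hP.abar_nonneg) _

/-- The flow is nonexpansive and the discount factor has total mass `1/δ`, whence the constant
`ā/δ`. -/
theorem cost_le_add (hP : P.Standing) {h : ℝ → ℝ} {a b : ℝ} (hh : h ∈ P.Adm)
    (ha : a ∈ Icc 0 P.gmax) (hb : b ∈ Icc 0 P.gmax) (hab : a ≤ b) :
    P.cost h b ≤ P.cost h a + P.Lv * (b - a) := by
  have sa := isState_state hP hh ha
  have sb := isState_state hP hh hb
  have h1 : P.Lv * (b - a) = ∫ t in Ioi (0 : ℝ), Real.exp (-P.del * t) * (P.abar * (b - a)) := by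
    rw [integral_mul_const, hP.integral_exp]; unfold Lv; ring
  have hi : IntegrableOn (fun t => Real.exp (-P.del * t) * (P.abar * (b - a))) (Ioi 0) :=
    hP.integrableOn_exp.mul_const _
  rw [h1]
  unfold cost
  rw [← integral_add (sa.integrableOn_k hP hh ha) hi]
  refine setIntegral_mono_on (sb.integrableOn_k hP hh hb) ((sa.integrableOn_k hP hh ha).add hi)
    measurableSet_Ioi fun t ht => ?_
  rw [← mul_add]
  refine mul_le_mul_of_nonneg_left ?_ (Real.exp_pos _).le
  have := mul_le_mul_of_nonneg_left (sa.sub_le_sub hP hh ha.1 hab sb t (le_of_lt ht))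
    hP.abar_nonneg
  unfold k
  linarith

theorem cost_concave (hP : P.Standing) {h : ℝ → ℝ} {a b p q : ℝ} (hh : h ∈ P.Adm)
    (ha : a ∈ Icc 0 P.gmax) (hb : b ∈ Icc 0 P.gmax) (hp : 0 ≤ p) (hq : 0 ≤ q) (hpq : p + q = 1) :
    p * P.cost h a + q * P.cost h b ≤ P.cost h (p * a + q * b) := by
  have hg0 : p * a + q * b ∈ Icc 0 P.gmax := convex_Icc _ _ ha hb hp hq hpq
  have sa := isState_state hP hh ha
  have sb := isState_state hP hh hb
  have sg := isState_state hP hh hg0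
  have ia := (sa.integrableOn_k hP hh ha).const_mul p
  have ib := (sb.integrableOn_k hP hh hb).const_mul q
  unfold cost
  rw [← integral_const_mul, ← integral_const_mul, ← integral_add ia ib]
  refine setIntegral_mono_on (ia.add ib) (sg.integrableOn_k hP hh hg0) measurableSet_Ioi
    fun t ht => ?_
  have h1 := mul_le_mul_of_nonneg_left (IsState.concave hP hh ha.1 hb.1 hp hq hpq sa sb sg t
    (le_of_lt ht))
    hP.abar_nonneg
  have h2 := (Real.exp_pos (-P.del * t)).le
  have h3 : p * P.k (P.state h a t) (h t) + q * P.k (P.state h b t) (h t) ≤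
      P.k (P.state h (p * a + q * b) t) (h t) := by
    have : P.c (h t) = p * P.c (h t) + q * P.c (h t) := by rw [← add_mul, hpq, one_mul]
    unfold k
    linarith
  nlinarith [mul_le_mul_of_nonneg_left h3 h2]

/-- The mixed control competes from `g`: its state lies below the mixed states, and its information
cost below the mixed costs by convexity of `c`. -/
theorem cost_mix_le (hP : P.Standing) {h₁ h₂ : ℝ → ℝ} {a b g p q : ℝ} (hh₁ : h₁ ∈ P.Adm)
    (hh₂ : h₂ ∈ P.Adm) (ha : a ∈ Ioc 0 P.gmax) (hb : b ∈ Ioc 0 P.gmax) (hg : g ∈ Ioc 0 P.gmax)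
    (hp : 0 ≤ p) (hq : 0 ≤ q) (hpq : p + q = 1) (hmix : g⁻¹ = p * a⁻¹ + q * b⁻¹) :
    P.value g ≤ p * P.cost h₁ a + q * P.cost h₂ b := by
  have hh : (fun t => p * h₁ t + q * h₂ t) ∈ P.Adm :=
    ⟨(hh₁.1.const_mul p).add (hh₂.1.const_mul q), fun t ht =>
      convex_Icc _ _ (hh₁.2 t ht) (hh₂.2 t ht) hp hq hpq⟩
  have ha' := Ioc_subset_Icc_self ha
  have hb' := Ioc_subset_Icc_self hb
  have hg' := Ioc_subset_Icc_self hg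
  have sa := isState_state hP hh₁ ha'
  have sb := isState_state hP hh₂ hb'
  have sg := isState_state hP hh hg'
  have ia := (sa.integrableOn_k hP hh₁ ha').const_mul p
  have ib := (sb.integrableOn_k hP hh₂ hb').const_mul q
  refine (value_le_cost hP hh hg').trans ?_
  unfold cost
  rw [← integral_const_mul, ← integral_const_mul, ← integral_add ia ib]
  refine setIntegral_mono_on (sg.integrableOn_k hP hh hg') (ia.add ib) measurableSet_Ioi
    fun t ht => ?_
  have ht' : 0 ≤ t := le_of_lt ht
  have h1 := mul_le_mul_of_nonneg_left
    (IsState.le_mix hP hh hh₁ hh₂ ha hb hg hp hq hpq (fun _ => rfl) hmix sa sb sg ht')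
    hP.abar_nonneg
  have h2 := (Real.exp_pos (-P.del * t)).le
  have h3 := hP.c_strictConvex.convexOn.2 (hh₁.2 t ht').1 (hh₂.2 t ht').1 hp hq hpq
  simp only [smul_eq_mul] at h3
  have h4 : P.k (P.state (fun t => p * h₁ t + q * h₂ t) g t) (p * h₁ t + q * h₂ t) ≤
      p * P.k (P.state h₁ a t) (h₁ t) + q * P.k (P.state h₂ b t) (h₂ t) := by
    unfold k
    linarith
  nlinarith [mul_le_mul_of_nonneg_left h4 h2]

theorem monotoneOn_value (hP : P.Standing) : MonotoneOn P.value (Icc 0 P.gmax) :=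
  fun _ ha _ hb hab => le_value hP fun _ hh =>
    (value_le_cost hP hh ha).trans (cost_mono hP hh ha hb hab)

theorem value_sub_le (hP : P.Standing) : ∀ a ∈ Icc 0 P.gmax, ∀ b ∈ Icc 0 P.gmax, a ≤ b →
    P.value b - P.value a ≤ P.Lv * (b - a) := by
  intro a ha b hb hab
  have : P.value b - P.Lv * (b - a) ≤ P.value a := le_value hP fun h hh => by
    linarith [value_le_cost hP hh hb, cost_le_add hP hh ha hb hab]
  linarith

theorem concaveOn_value (hP : P.Standing) : ConcaveOn ℝ (Icc 0 P.gmax) P.value := by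
  refine ⟨convex_Icc _ _, fun a ha b hb p q hp hq hpq => le_value hP fun h hh => ?_⟩
  refine le_trans ?_ (cost_concave hP hh ha hb hp hq hpq)
  simp only [smul_eq_mul]
  exact add_le_add (mul_le_mul_of_nonneg_left (value_le_cost hP hh ha) hp)
    (mul_le_mul_of_nonneg_left (value_le_cost hP hh hb) hq)

theorem convexOn_value_inv (hP : P.Standing) :
    ConvexOn ℝ (Ici P.gmax⁻¹) fun y => P.value y⁻¹ := by
  have hm : ∀ y ∈ Ici P.gmax⁻¹, y⁻¹ ∈ Ioc 0 P.gmax := fun y hy => by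
    have hy0 : 0 < y := (inv_pos.2 hP.gmax_pos).trans_le hy
    exact ⟨inv_pos.2 hy0, inv_le_of_inv_le₀ hP.gmax_pos hy⟩
  refine ⟨convex_Ici _, fun y hy z hz p q hp hq hpq => le_mix_value hP hp hq fun h₁ hh₁ h₂ hh₂ => ?_⟩
  exact cost_mix_le hP hh₁ hh₂ (hm y hy) (hm z hz) (hm _ (convex_Ici _ hy hz hp hq hpq)) hp hq hpq
    (by simp)

theorem differentiableOn_value (hP : P.Standing) : DifferentiableOn ℝ P.value (Icc 0 P.gmax) :=
  differentiableOn_of_concaveOn_of_convexOn_inv hP.gmax_pos (concaveOn_value hP)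
    (monotoneOn_value hP) (value_sub_le hP) (convexOn_value_inv hP)

theorem contDiffOn_value (hP : P.Standing) : ContDiffOn ℝ 1 P.value (Icc 0 P.gmax) :=
  (concaveOn_value hP).contDiffOn_one_Icc hP.gmax_pos (differentiableOn_value hP)

theorem hasDerivWithinAt_value (hP : P.Standing) {g : ℝ} (hg : g ∈ Icc 0 P.gmax) :
    HasDerivWithinAt P.value (P.D P.value g) (Icc 0 P.gmax) g :=
  (differentiableOn_value hP g hg).hasDerivWithinAt

theorem continuousOn_D_value (hP : P.Standing) : ContinuousOn (P.D P.value) (Icc 0 P.gmax) :=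
  (contDiffOn_value hP).continuousOn_derivWithin (uniqueDiffOn_Icc hP.gmax_pos) le_rfl

theorem D_value_nonneg (hP : P.Standing) (g : ℝ) : 0 ≤ P.D P.value g :=
  (monotoneOn_value hP).derivWithin_nonneg

theorem D_value_le (hP : P.Standing) {g : ℝ} (hg : g ∈ Icc 0 P.gmax) : P.D P.value g ≤ P.Lv := by
  have hm : MonotoneOn (fun x => P.Lv * x - P.value x) (Icc 0 P.gmax) := fun a ha b hb hab => by
    have := value_sub_le hP a ha b hb hab
    simp only
    linarith
  have h1 : HasDerivWithinAt (fun x => P.Lv * x - P.value x) (P.Lv * 1 - P.D P.value g)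
      (Icc 0 P.gmax) g :=
    ((hasDerivWithinAt_id g _).const_mul P.Lv).sub (hasDerivWithinAt_value hP hg)
  have h2 := hm.derivWithin_nonneg (x := g)
  rw [h1.derivWithin (uniqueDiffOn_Icc hP.gmax_pos g hg)] at h2
  linarith

theorem monotoneOn_sq_mul_D_value (hP : P.Standing) :
    MonotoneOn (fun g => g ^ 2 * P.D P.value g) (Icc 0 P.gmax) :=
  monotoneOn_sq_mul_derivWithin hP.gmax_pos (differentiableOn_value hP) (monotoneOn_value hP)
    (convexOn_value_inv hP)

/-- The marginal benefit of observation never exceeds `M₀ = c'(h_max)`, so restricting rates to `[0,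
h_max]` loses nothing in the HJB infimum. -/
theorem sq_mul_D_value_mem (hP : P.Standing) {g : ℝ} (hg : g ∈ Icc 0 P.gmax) :
    g ^ 2 * P.D P.value g ∈ Icc 0 P.M0 :=
  ⟨mul_nonneg (sq_nonneg _) (D_value_nonneg hP g),
    mul_le_mul (pow_le_pow_left₀ hg.1 hg.2 2) (D_value_le hP hg) (D_value_nonneg hP g)
      (sq_nonneg _)⟩

end Value

end AcqModel

/-! ### Dynamic programming and verification. -/

theorem integral_comp_add_right_Ioi (F : ℝ → ℝ) (T : ℝ) :
    ∫ s in Ioi (0 : ℝ), F (s + T) = ∫ s in Ioi T, F s := by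
  have := (measurePreserving_add_right volume T).setIntegral_preimage_emb
    (MeasurableEquiv.addRight T).measurableEmbedding F (Ioi T)
  rwa [preimage_add_const_Ioi, sub_self] at this

namespace AcqModel

section Verification

variable {P : AcqModel}

/-- The expression under the infimum of the HJB equation of the value function. -/
noncomputable def gap (P : AcqModel) (g h : ℝ) : ℝ :=
  P.k g h + P.f g h * P.D P.value g - P.del * P.value g

theorem value_nonneg (hP : P.Standing) {g : ℝ} (hg : g ∈ Icc 0 P.gmax) : 0 ≤ P.value g :=
  le_value hP fun _ hh => cost_nonneg hP hh hg

theorem value_le (hP : P.Standing) {g : ℝ} (hg : g ∈ Icc 0 P.gmax) : P.value g ≤ P.value P.gmax :=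
  monotoneOn_value hP hg ⟨hP.gmax_pos.le, le_rfl⟩ hg.2

namespace IsState

variable {h g : ℝ → ℝ} {g0 : ℝ}

/-- Chain rule for the discounted value along a state. -/
theorem exp_mul_value (hP : P.Standing) (hh : h ∈ P.Adm) (hg0 : g0 ∈ Icc 0 P.gmax)
    (hg : P.IsState h g0 g) {T : ℝ} (hT : 0 ≤ T) :
    Real.exp (-P.del * T) * P.value (g T) = P.value g0 + ∫ s in (0 : ℝ)..T,
      Real.exp (-P.del * s) * (P.D P.value (g s) * P.f (g s) (h s) - P.del * P.value (g s)) :=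
  exp_mul_comp_eq_add_integral (w' := P.D P.value) P.del hT (intervalIntegrable_f hh hg.1 le_rfl hT)
    (fun s hs => hP.abs_f_le (hg.mem_Icc hP hh hg0 s hs.1) (hh.2 s hs.1))
    (fun s hs => hg.2 s hs.1) (fun s hs => hg.mem_Icc hP hh hg0 s hs.1)
    (fun _ hz => hasDerivWithinAt_value hP hz)
    (fun z hz => by rw [abs_of_nonneg (D_value_nonneg hP z)]; exact D_value_le hP hz)

theorem integrableOn_drift (hP : P.Standing) (hh : h ∈ P.Adm) (hg0 : g0 ∈ Icc 0 P.gmax)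
    (hg : P.IsState h g0 g) : IntegrableOn (fun s => Real.exp (-P.del * s) *
      (P.D P.value (g s) * P.f (g s) (h s) - P.del * P.value (g s))) (Ioi 0) := by
  have hmem := hg.mem_Icc hP hh hg0
  have hD : ContinuousOn (fun s => P.D P.value (g s)) (Ici 0) :=
    (continuousOn_D_value hP).comp hg.1 hmem
  have hv : ContinuousOn (fun s => P.value (g s)) (Ici 0) :=
    (contDiffOn_value hP).continuousOn.comp hg.1 hmem
  have hf : AEStronglyMeasurable (fun s => P.f (g s) (h s)) (volume.restrict (Ioi 0)) := by
    have h1 := aestronglyMeasurable_adm hh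
    have h2 := aestronglyMeasurable_of_continuousOn hg.1
    have h3 := aestronglyMeasurable_of_continuousOn (hg.1.pow 2)
    exact ((((aestronglyMeasurable_const (b := (1 / P.sig1) ^ 2)).add h1).neg.mul h3).sub
      (h2.const_mul (2 * P.lam))).add aestronglyMeasurable_const
  refine hP.integrableOn_exp_mul (C := P.Lv * (((1 / P.sig1) ^ 2 + P.hmax) * P.gmax ^ 2
      + 2 * P.lam * P.gmax + P.sig2 ^ 2) + P.del * P.value P.gmax)
    (((aestronglyMeasurable_of_continuousOn hD).mul hf).sub
      ((aestronglyMeasurable_of_continuousOn hv).const_mul P.del)) fun t ht => ?_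
  refine (abs_sub _ _).trans (add_le_add ?_ ?_)
  · rw [abs_mul, abs_of_nonneg (D_value_nonneg hP _)]
    exact mul_le_mul (D_value_le hP (hmem t ht)) (hP.abs_f_le (hmem t ht) (hh.2 t ht))
      (abs_nonneg _) ((D_value_nonneg hP _).trans (D_value_le hP (hmem t ht)))
  · rw [abs_mul, abs_of_pos hP.del_pos, abs_of_nonneg (value_nonneg hP (hmem t ht))]
    exact mul_le_mul_of_nonneg_left (value_le hP (hmem t ht)) hP.del_pos.le

theorem exp_mul_gap_eq (s : ℝ) : Real.exp (-P.del * s) * P.gap (g s) (h s) =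
    Real.exp (-P.del * s) * P.k (g s) (h s) + Real.exp (-P.del * s) *
      (P.D P.value (g s) * P.f (g s) (h s) - P.del * P.value (g s)) := by
  unfold gap; ring

theorem integrableOn_gap (hP : P.Standing) (hh : h ∈ P.Adm) (hg0 : g0 ∈ Icc 0 P.gmax)
    (hg : P.IsState h g0 g) :
    IntegrableOn (fun s => Real.exp (-P.del * s) * P.gap (g s) (h s)) (Ioi 0) := by
  simp_rw [exp_mul_gap_eq]
  exact (hg.integrableOn_k hP hh hg0).add (hg.integrableOn_drift hP hh hg0)

/-- The verification identity. -/
theorem cost_eq_value_add (hP : P.Standing) (hh : h ∈ P.Adm) (hg0 : g0 ∈ Icc 0 P.gmax)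
    (hg : P.IsState h g0 g) : P.cost h g0 =
      P.value g0 + ∫ s in Ioi (0 : ℝ), Real.exp (-P.del * s) * P.gap (g s) (h s) := by
  have hk := hg.integrableOn_k hP hh hg0
  have hd := hg.integrableOn_drift hP hh hg0
  have hmem := hg.mem_Icc hP hh hg0
  simp_rw [exp_mul_gap_eq]
  rw [integral_add hk hd, ← hg.cost_eq hP hh hg0]
  have h1 := intervalIntegral_tendsto_integral_Ioi 0 hd tendsto_id
  -- Transversality: the value is bounded on the state space, so its discounted terminal
  -- contribution vanishes.
  have h2 : Tendsto (fun T => Real.exp (-P.del * T) * P.value (g T) - P.value g0) atTop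
      (𝓝 (0 - P.value g0)) := by
    refine Tendsto.sub_const ?_ _
    have he : Tendsto (fun T => Real.exp (-P.del * T) * P.value P.gmax) atTop (𝓝 0) := by
      have : Tendsto (fun T : ℝ => -P.del * T) atTop atBot :=
        tendsto_id.const_mul_atTop_of_neg (by linarith [hP.del_pos])
      simpa using (Real.tendsto_exp_atBot.comp this).mul_const (P.value P.gmax)
    refine tendsto_of_tendsto_of_tendsto_of_le_of_le' tendsto_const_nhds he ?_ ?_
    · filter_upwards [eventually_ge_atTop 0] with T hT
      exact mul_nonneg (Real.exp_pos _).le (value_nonneg hP (hmem T hT))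
    · filter_upwards [eventually_ge_atTop 0] with T hT
      exact mul_le_mul_of_nonneg_left (value_le hP (hmem T hT)) (Real.exp_pos _).le
  have h3 := tendsto_nhds_unique h1 (h2.congr' ?_)
  · rw [h3]; ring
  · filter_upwards [eventually_ge_atTop 0] with T hT
    rw [hg.exp_mul_value hP hh hg0 hT]; simp

/-- Concatenation of a control with one that takes over at time `T`. -/
theorem concat {h' g' : ℝ → ℝ} (hh : h ∈ P.Adm) (hh' : h' ∈ P.Adm)
    (hg : P.IsState h g0 g) {T : ℝ} (hT : 0 ≤ T) (hg' : P.IsState h' (g T) g') :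
    ∃ h'' ∈ P.Adm, ∃ g'', P.IsState h'' g0 g'' ∧
      (∀ s, s ∈ Icc 0 T → h'' s = h s ∧ g'' s = g s) ∧
      ∀ s, T < s → h'' s = h' (s - T) ∧ g'' s = g' (s - T) := by
  let h'' : ℝ → ℝ := fun s => if s ≤ T then h s else h' (s - T)
  -- A gluing formula without case distinction, so continuity at `T` needs no separate check.
  let g'' : ℝ → ℝ := fun s => g (min s T) + (g' (max (s - T) 0) - g T)
  have e1 : ∀ s, s ≤ T → h'' s = h s ∧ g'' s = g s := fun s hs => by
    refine ⟨if_pos hs, ?_⟩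
    simp only [g'', min_eq_left hs, max_eq_right (sub_nonpos.2 hs), hg'.apply_zero]
    ring
  have e2 : ∀ s, T < s → h'' s = h' (s - T) ∧ g'' s = g' (s - T) := fun s hs => by
    refine ⟨if_neg (not_le.2 hs), ?_⟩
    simp only [g'', min_eq_right hs.le, max_eq_left (sub_nonneg.2 hs.le)]
    ring
  have hadm : h'' ∈ P.Adm := by
    constructor
    · have hm : Measurable fun s : ℝ => if s ≤ T then h (max s 0) else h' (max (s - T) 0) :=
        Measurable.ite measurableSet_Iic (measurable_comp_max hh)
          ((measurable_comp_max hh').comp (measurable_id.sub_const T))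
      have : (Ici (0 : ℝ)).domRestrict h'' = fun s : Ici (0 : ℝ) =>
          if (s : ℝ) ≤ T then h (max s 0) else h' (max (s - T) 0) := by
        funext s
        have hs : (0 : ℝ) ≤ s := s.2
        by_cases hsT : (s : ℝ) ≤ T
        · simp [h'', hsT, max_eq_left hs]
        · have : 0 ≤ (s : ℝ) - T := by linarith
          simp [h'', hsT, max_eq_left this]
      rw [this]
      exact hm.comp measurable_subtype_coe
    · intro t ht
      by_cases htT : t ≤ T
      · rw [(e1 t htT).1]; exact hh.2 t ht
      · rw [(e2 t (not_le.1 htT)).1]; exact hh'.2 _ (by linarith)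
  have hcont : ContinuousOn g'' (Ici 0) := by
    refine ContinuousOn.add ?_ (ContinuousOn.sub ?_ continuousOn_const)
    · exact hg.1.comp (by fun_prop) fun s hs => mem_Ici.2 (le_min hs hT)
    · exact hg'.1.comp (by fun_prop) fun s _ => mem_Ici.2 (le_max_right _ _)
  have hfirst : ∀ t, 0 ≤ t → t ≤ T → ∫ s in (0 : ℝ)..t, P.f (g'' s) (h'' s) =
      ∫ s in (0 : ℝ)..t, P.f (g s) (h s) := by
    intro t ht htT
    refine intervalIntegral.integral_congr fun s hs => ?_
    rw [uIcc_of_le ht] at hs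
    have := e1 s (hs.2.trans htT)
    simp only [this.1, this.2]
  refine ⟨h'', hadm, g'', ⟨hcont, fun t ht => ?_⟩, fun s hs => e1 s hs.2, e2⟩
  rcases le_or_gt t T with htT | htT
  · rw [(e1 t htT).2, hg.2 t ht, hfirst t ht htT]
  · rw [← intervalIntegral.integral_add_adjacent_intervals
      (intervalIntegrable_f hadm hcont le_rfl hT) (intervalIntegrable_f hadm hcont hT ht),
      hfirst T hT le_rfl, ← add_assoc, ← hg.2 T hT, (e2 t htT).2, hg'.2 _ (by linarith)]
    congr 1
    have : ∫ s in T..t, P.f (g'' s) (h'' s) =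
        ∫ s in T..t, (fun r => P.f (g' r) (h' r)) (s - T) := by
      refine intervalIntegral.integral_congr_ae (ae_of_all _ fun s hs => ?_)
      rw [uIoc_of_le htT.le] at hs
      have := e2 s hs.1
      simp only [this.1, this.2]
    rw [this, intervalIntegral.integral_comp_sub_right (fun r => P.f (g' r) (h' r)) T, sub_self]

/-- One half of the dynamic programming principle. -/
theorem value_le_integral_add (hP : P.Standing) (hh : h ∈ P.Adm) (hg0 : g0 ∈ Icc 0 P.gmax)
    (hg : P.IsState h g0 g) {T : ℝ} (hT : 0 ≤ T) :
    P.value g0 ≤ (∫ s in (0 : ℝ)..T, Real.exp (-P.del * s) * P.k (g s) (h s))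
      + Real.exp (-P.del * T) * P.value (g T) := by
  have hgT := hg.mem_Icc hP hh hg0 T hT
  set I := ∫ s in (0 : ℝ)..T, Real.exp (-P.del * s) * P.k (g s) (h s)
  have key : ∀ h' ∈ P.Adm, P.value g0 ≤ I + Real.exp (-P.del * T) * P.cost h' (g T) := by
    intro h' hh'
    have hg' := isState_state hP hh' hgT
    obtain ⟨h'', hadm, g'', hst, e1, e2⟩ := hg.concat hh hh' hT hg'
    refine (value_le_cost hP hadm hg0).trans_eq ?_
    have hint := hst.integrableOn_k hP hadm hg0
    rw [hst.cost_eq hP hadm hg0, ← intervalIntegral.integral_interval_add_Ioi hint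
      (hint.mono_set (Ioi_subset_Ioi hT))]
    congr 1
    · refine intervalIntegral.integral_congr fun s hs => ?_
      rw [uIcc_of_le hT] at hs
      simp only [(e1 s hs).1, (e1 s hs).2]
    · rw [← integral_comp_add_right_Ioi]
      unfold cost
      rw [← integral_const_mul]
      refine setIntegral_congr_fun measurableSet_Ioi fun s hs => ?_
      have h2 := e2 (s + T) (by linarith [mem_Ioi.1 hs])
      simp only [h2.1, h2.2, add_sub_cancel_right]
      rw [← mul_assoc, ← Real.exp_add]
      ring_nf
  have hexp := Real.exp_pos (-P.del * T)
  have : (P.value g0 - I) / Real.exp (-P.del * T) ≤ P.value (g T) :=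
    le_value hP fun h' hh' => by
      rw [div_le_iff₀ hexp]
      linarith [key h' hh']
  rw [div_le_iff₀ hexp] at this
  linarith

end IsState

theorem continuousOn_f_comp {u H : ℝ → ℝ} {S : Set ℝ} (hu : ContinuousOn u S)
    (hH : ContinuousOn H S) : ContinuousOn (fun s => P.f (u s) (H s)) S := by
  unfold f
  fun_prop

theorem continuousOn_gap_comp (hP : P.Standing) {H : ℝ → ℝ} (hH : ContinuousOn H (Icc 0 P.gmax))
    (hmem : ∀ g ∈ Icc 0 P.gmax, 0 ≤ H g) :
    ContinuousOn (fun g => P.gap g (H g)) (Icc 0 P.gmax) := by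
  have h1 := continuousOn_D_value hP
  have h2 := (contDiffOn_value hP).continuousOn
  have h3 : ContinuousOn (fun g => P.c (H g)) (Icc 0 P.gmax) := hP.continuousOn_c.comp hH hmem
  have h4 := continuousOn_f_comp (P := P) continuousOn_id hH
  unfold gap k
  exact (((continuousOn_const.mul continuousOn_id).add h3).add (h4.mul h1)).sub
    (continuousOn_const.mul h2)

/-- A negative gap at `g0` would stay negative for a short time under the constant control `h`;
using `h` for that time and continuing near-optimally would then beat `v(g0)`. -/
theorem gap_nonneg (hP : P.Standing) {g0 h : ℝ} (hg0 : g0 ∈ Icc 0 P.gmax) (hh : h ∈ Icc 0 P.hmax) :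
    0 ≤ P.gap g0 h := by
  have hadm := const_mem_adm hh
  have hg := isState_state hP hadm hg0
  set g := P.state (fun _ => h) g0
  have hmem := hg.mem_Icc hP hadm hg0
  by_contra! hneg
  have hc : ContinuousOn (fun s => P.gap (g s) h) (Ici 0) :=
    (continuousOn_gap_comp hP continuousOn_const fun _ _ => hh.1).comp hg.1 hmem
  have hev : ∀ᶠ s in 𝓝[≥] (0 : ℝ), P.gap (g s) h < 0 := by
    refine (hc 0 self_mem_Ici).eventually_lt_const ?_
    simpa only [hg.apply_zero] using hneg
  obtain ⟨T, hT, hTs⟩ := mem_nhdsGE_iff_exists_Ico_subset.1 hev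
  have hT0 : (0 : ℝ) < T := hT
  have hi := hg.integrableOn_gap hP hadm hg0
  have hi' : ∀ {φ : ℝ → ℝ}, IntegrableOn φ (Ioi 0) → IntervalIntegrable φ volume 0 T := fun hφ =>
    (intervalIntegrable_iff_integrableOn_Ioc_of_le hT0.le).2 (hφ.mono_set Ioc_subset_Ioi_self)
  have hpos := intervalIntegral.intervalIntegral_pos_of_pos_on (hi' hi).neg
    (fun s hs => by
      have := hTs (Ioo_subset_Ico_self hs)
      exact neg_pos.2 (mul_neg_of_pos_of_neg (Real.exp_pos _) this)) hT0
  simp only [Pi.neg_apply, intervalIntegral.integral_neg] at hpos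
  have h1 := hg.value_le_integral_add hP hadm hg0 hT0.le
  rw [hg.exp_mul_value hP hadm hg0 hT0.le] at h1
  have h2 : ∫ s in (0 : ℝ)..T, Real.exp (-P.del * s) * P.gap (g s) h =
      (∫ s in (0 : ℝ)..T, Real.exp (-P.del * s) * P.k (g s) h) + ∫ s in (0 : ℝ)..T,
      Real.exp (-P.del * s) * (P.D P.value (g s) * P.f (g s) h - P.del * P.value (g s)) := by
    rw [← intervalIntegral.integral_add (hi' (hg.integrableOn_k hP hadm hg0))
      (hi' (hg.integrableOn_drift hP hadm hg0))]
    exact intervalIntegral.integral_congr fun s _ => IsState.exp_mul_gap_eq (h := fun _ => h) s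
  linarith

/-! ### The pointwise maximiser `ĥ`. -/

section HHat

theorem strictConcaveOn_mul_sub (hP : P.Standing) (x : ℝ) :
    StrictConcaveOn ℝ (Icc 0 P.hmax) fun h => h * x - P.c h := by
  have h1 : StrictConvexOn ℝ (Icc 0 P.hmax) P.c :=
    hP.c_strictConvex.subset Icc_subset_Ici_self (convex_Icc _ _)
  have h2 : ConcaveOn ℝ (Icc 0 P.hmax) fun h => h * x :=
    ⟨convex_Icc _ _, fun a _ b _ p q _ _ _ => by simp only [smul_eq_mul]; linarith⟩
  exact h2.sub_strictConvexOn h1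

theorem hHat_spec (hP : P.Standing) (x : ℝ) : P.hHat x ∈ Icc 0 P.hmax ∧
    IsMaxOn (fun h => h * x - P.c h) (Icc 0 P.hmax) (P.hHat x) := by
  have hc : ContinuousOn (fun h => h * x - P.c h) (Icc 0 P.hmax) :=
    (by fun_prop : ContinuousOn (fun h : ℝ => h * x) (Icc 0 P.hmax)).sub
      (hP.continuousOn_c.mono Icc_subset_Ici_self)
  obtain ⟨h, hh, hmax⟩ := isCompact_Icc.exists_isMaxOn (nonempty_Icc.2 hP.hmax_nonneg) hc
  exact Classical.epsilon_spec (p := fun h => h ∈ Icc 0 P.hmax ∧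
    IsMaxOn (fun h' => h' * x - P.c h') (Icc 0 P.hmax) h) ⟨h, hh, hmax⟩

theorem eq_hHat (hP : P.Standing) {x h : ℝ} (hh : h ∈ Icc 0 P.hmax)
    (hmax : IsMaxOn (fun h => h * x - P.c h) (Icc 0 P.hmax) h) : h = P.hHat x :=
  (strictConcaveOn_mul_sub hP x).eq_of_isMaxOn hmax (hHat_spec hP x).2 hh (hHat_spec hP x).1

/-- Maximisers lie in a compact interval, and by continuity any cluster point of them is again a
maximiser; strict concavity makes it unique. -/
theorem continuous_hHat (hP : P.Standing) : Continuous P.hHat := by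
  refine continuous_iff_continuousAt.2 fun x => ?_
  refine isCompact_Icc.tendsto_nhds_of_unique_mapClusterPt
    (Eventually.of_forall fun z => (hHat_spec hP z).1) fun y hy hcl => eq_hHat hP hy ?_
  obtain ⟨U, hU, hUy⟩ := mapClusterPt_iff_ultrafilter.1 hcl
  have hUc : Tendsto (fun z => P.c (P.hHat z)) U (𝓝 (P.c y)) :=
    (hP.continuousOn_c y hy.1).tendsto.comp (tendsto_nhdsWithin_iff.2
      ⟨hUy, Eventually.of_forall fun z => (hHat_spec hP z).1.1⟩)
  have hUx : Tendsto (fun z : ℝ => z) U (𝓝 x) := hU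
  intro h' hh'
  exact le_of_tendsto_of_tendsto' ((hUx.const_mul h').sub_const (P.c h'))
    ((hUy.mul hUx).sub hUc) fun z => (hHat_spec hP z).2 hh'

/-- Exchange argument: adding the two optimality inequalities cancels the costs. -/
theorem monotone_hHat (hP : P.Standing) : Monotone P.hHat := by
  intro x y hxy
  rcases hxy.eq_or_lt with rfl | hlt
  · exact le_rfl
  have h1 := (hHat_spec hP x).2 (hHat_spec hP y).1
  have h2 := (hHat_spec hP y).2 (hHat_spec hP x).1
  simp only [mem_ofPred_eq] at h1 h2
  by_contra! hcon
  nlinarith [mul_pos (sub_pos.2 hlt) (sub_pos.2 hcon)]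

end HHat

/-! ### The feedback map and the HJB equation. -/

theorem Hstar_mem (hP : P.Standing) (g : ℝ) : P.Hstar g ∈ Icc 0 P.hmax := (hHat_spec hP _).1

theorem continuousOn_Hstar (hP : P.Standing) : ContinuousOn P.Hstar (Icc 0 P.gmax) :=
  (continuous_hHat hP).comp_continuousOn ((continuousOn_id.pow 2).mul (continuousOn_D_value hP))

theorem monotoneOn_Hstar (hP : P.Standing) : MonotoneOn P.Hstar (Icc 0 P.gmax) :=
  fun _ ha _ hb hab => monotone_hHat hP (monotoneOn_sq_mul_D_value hP ha hb hab)

theorem gap_eq (g h : ℝ) : P.gap g h = P.gap g 0 - P.c 0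
    - (h * (g ^ 2 * P.D P.value g) - P.c h) := by
  unfold gap k f; ring

theorem gap_Hstar_le (hP : P.Standing) {g h : ℝ} (hh : h ∈ Icc 0 P.hmax) :
    P.gap g (P.Hstar g) ≤ P.gap g h := by
  rw [gap_eq g h, gap_eq g (P.Hstar g)]
  have := (hHat_spec hP (g ^ 2 * P.D P.value g)).2 hh
  simp only [mem_ofPred_eq] at this
  change _ ≤ P.Hstar g * _ - P.c (P.Hstar g) at this
  linarith

theorem eq_Hstar (hP : P.Standing) {g h : ℝ} (hh : h ∈ Icc 0 P.hmax)
    (hle : P.gap g h ≤ P.gap g (P.Hstar g)) : h = P.Hstar g := by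
  refine eq_hHat hP hh fun h' hh' => ?_
  have := hle.trans (gap_Hstar_le hP hh' (g := g))
  rw [gap_eq g h, gap_eq g h'] at this
  simp only [mem_ofPred_eq]
  linarith

/-- Beyond `h_max` the secant slopes of `c` from `h_max` are at least `c'(h_max) = M₀ ≥ γ² v'(γ)`,
so a larger rate costs at least what it gains. -/
theorem gap_Hstar_le_of_nonneg (hP : P.Standing) {g h : ℝ} (hg : g ∈ Icc 0 P.gmax) (hh : 0 ≤ h) :
    P.gap g (P.Hstar g) ≤ P.gap g h := by
  rcases le_or_gt h P.hmax with hle | hlt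
  · exact gap_Hstar_le hP ⟨hh, hle⟩
  refine (gap_Hstar_le hP (h := P.hmax) ⟨hP.hmax_nonneg, le_rfl⟩).trans ?_
  rw [gap_eq g h, gap_eq g P.hmax]
  have h1 := hP.c_strictConvex.convexOn.derivWithin_le_slope (x := P.hmax) (y := h)
    hP.hmax_nonneg hh hlt
    (hP.c_contDiff_one.differentiableOn one_ne_zero _ hP.hmax_nonneg)
  change P.cDeriv P.hmax ≤ _ at h1
  rw [hP.cDeriv_hmax, slope_def_field, le_div_iff₀ (by linarith)] at h1
  have h2 := mul_le_mul_of_nonneg_right (sq_mul_D_value_mem hP hg).2 (sub_pos.2 hlt).le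
  linarith

/-- The HJB equation, with the infimum attained by the feedback. -/
theorem gap_Hstar (hP : P.Standing) {g0 : ℝ} (hg0 : g0 ∈ Icc 0 P.gmax) :
    P.gap g0 (P.Hstar g0) = 0 := by
  refine le_antisymm ?_ (gap_nonneg hP hg0 (Hstar_mem hP _))
  by_contra! hpos
  set η := P.gap g0 (P.Hstar g0) / 2 with hη
  have hηpos : 0 < η := by positivity
  have hc := continuousOn_gap_comp hP (continuousOn_Hstar hP) (fun g _ => (Hstar_mem hP g).1)
  have hev : ∀ᶠ g in 𝓝[Icc 0 P.gmax] g0, η < P.gap g (P.Hstar g) :=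
    (hc g0 hg0).eventually_const_lt (by linarith)
  obtain ⟨r, hr, hball⟩ := Metric.mem_nhdsWithin_iff.1 hev
  set C := ((1 / P.sig1) ^ 2 + P.hmax) * P.gmax ^ 2 + 2 * P.lam * P.gmax + P.sig2 ^ 2 with hC
  have hC0 : 0 ≤ C := (abs_nonneg _).trans (hP.abs_f_le hg0 (Hstar_mem hP g0))
  -- `C` bounds the speed under every control, so up to this time all states remain in the ball
  -- where the gap exceeds `η`. The resulting loss is independent of the control and survives the
  -- infimum.
  set T := r / (C + 1) with hTdef
  have hT : 0 < T := by positivity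
  have hbound : P.value g0 + T * (Real.exp (-P.del * T) * η) ≤ P.value g0 := by
    refine le_value hP fun h hh => ?_
    have hg := isState_state hP hh hg0
    set g := P.state h g0
    have hmem := hg.mem_Icc hP hh hg0
    have hi := hg.integrableOn_gap hP hh hg0
    rw [hg.cost_eq_value_add hP hh hg0, ← intervalIntegral.integral_interval_add_Ioi hi
      (hi.mono_set (Ioi_subset_Ioi hT.le))]
    have h1 : 0 ≤ ∫ s in Ioi T, Real.exp (-P.del * s) * P.gap (g s) (h s) :=
      setIntegral_nonneg measurableSet_Ioi fun s hs => by
        have hs0 : 0 ≤ s := hT.le.trans (le_of_lt hs)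
        exact mul_nonneg (Real.exp_pos _).le (gap_nonneg hP (hmem s hs0) (hh.2 s hs0))
    have h2 : ∫ s in (0 : ℝ)..T, Real.exp (-P.del * T) * η ≤
        ∫ s in (0 : ℝ)..T, Real.exp (-P.del * s) * P.gap (g s) (h s) := by
      refine intervalIntegral.integral_mono_on_of_le_Ioo hT.le (by simp)
        ((intervalIntegrable_iff_integrableOn_Ioc_of_le hT.le).2
          (hi.mono_set Ioc_subset_Ioi_self)) fun s hs => ?_
      have hd : dist (g s) g0 < r := by
        rw [Real.dist_eq]
        refine (hg.abs_sub_le hP hh hg0 hs.1.le).trans_lt ?_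
        rw [← hC]
        calc C * s ≤ C * T := mul_le_mul_of_nonneg_left hs.2.le hC0
          _ < (C + 1) * T := by nlinarith
          _ = r := by rw [hTdef]; field_simp
      have h3 : η < P.gap (g s) (P.Hstar (g s)) :=
        hball ⟨hd, hmem s hs.1.le⟩
      have h4 := h3.le.trans (gap_Hstar_le hP (hh.2 s hs.1.le))
      refine mul_le_mul (Real.exp_le_exp.2 ?_) h4 hηpos.le (Real.exp_pos _).le
      nlinarith [hP.del_pos, hs.2]
    rw [intervalIntegral.integral_const, smul_eq_mul, sub_zero] at h2
    linarith
  have : 0 < T * (Real.exp (-P.del * T) * η) := by positivity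
  linarith

theorem solvesHJB_value (hP : P.Standing) : P.SolvesHJB P.value := by
  refine ⟨contDiffOn_value hP, fun g hg => ?_⟩
  have hrw : ∀ h, P.f g h * P.D P.value g + P.abar * g + P.c h = P.gap g h + P.del * P.value g :=
    fun h => by unfold gap k; ring
  have hl : IsLeast ((fun h => P.f g h * P.D P.value g + P.abar * g + P.c h) '' Ici 0)
      (P.del * P.value g) := by
    constructor
    · exact ⟨P.Hstar g, (Hstar_mem hP g).1, by simp only [hrw, gap_Hstar hP hg, zero_add]⟩
    · rintro _ ⟨h, hh, rfl⟩
      have := gap_Hstar_le_of_nonneg hP hg hh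
      rw [gap_Hstar hP hg] at this
      simp only [hrw]
      linarith
  refine ⟨hl.bddBelow, ?_⟩
  rw [hl.csInf_eq]
  ring

end Verification

end AcqModel

/-! ### The closed-loop equation. -/

/-- Solutions of an autonomous dissipative equation are unique. -/
theorem eqOn_of_eq_add_integral_of_antitoneOn {F x y : ℝ → ℝ} {a b x0 : ℝ}
    (hF : ContinuousOn F (Icc a b)) (hanti : AntitoneOn F (Icc a b))
    (hxc : ContinuousOn x (Ici 0)) (hyc : ContinuousOn y (Ici 0))
    (hxm : ∀ t, 0 ≤ t → x t ∈ Icc a b) (hym : ∀ t, 0 ≤ t → y t ∈ Icc a b)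
    (hx : ∀ t, 0 ≤ t → x t = x0 + ∫ s in (0 : ℝ)..t, F (x s))
    (hy : ∀ t, 0 ≤ t → y t = x0 + ∫ s in (0 : ℝ)..t, F (y s)) : EqOn x y (Ici 0) := by
  have hle : ∀ {x y : ℝ → ℝ}, ContinuousOn x (Ici 0) → ContinuousOn y (Ici 0) →
      (∀ t, 0 ≤ t → x t ∈ Icc a b) → (∀ t, 0 ≤ t → y t ∈ Icc a b) →
      (∀ t, 0 ≤ t → x t = x0 + ∫ s in (0 : ℝ)..t, F (x s)) →
      (∀ t, 0 ≤ t → y t = x0 + ∫ s in (0 : ℝ)..t, F (y s)) → ∀ t, 0 ≤ t → x t ≤ y t := by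
    intro x y hxc hyc hxm hym hx hy t ht
    have hi : ∀ {z : ℝ → ℝ}, ContinuousOn z (Ici 0) → (∀ t, 0 ≤ t → z t ∈ Icc a b) →
        ∀ r, 0 ≤ r → IntervalIntegrable (fun s => F (z s)) volume 0 r := fun hzc hzm r hr =>
      ((hF.comp hzc hzm).mono (by rw [uIcc_of_le hr]; exact Icc_subset_Ici_self)).intervalIntegrable
    have := nonpos_of_eq_add_integral (x := fun t => x t - y t) (φ := fun s => F (x s) - F (y s))
      (T := t) (L := 0) (x0 := 0) ((hxc.sub hyc).mono Icc_subset_Ici_self)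
      ((hi hxc hxm t ht).sub (hi hyc hym t ht))
      (fun r hr => by
        rw [intervalIntegral.integral_sub (hi hxc hxm r hr.1) (hi hyc hym r hr.1), hx r hr.1,
          hy r hr.1]; ring) le_rfl le_rfl
      (fun s hs hpos => by
        have := hanti (hym s hs.1) (hxm s hs.1) (by linarith)
        linarith) t ⟨ht, le_rfl⟩
    linarith
  exact fun t ht => le_antisymm (hle hxc hyc hxm hym hx hy t ht) (hle hyc hxc hym hxm hy hx t ht)

namespace AcqModel

section ClosedLoop

variable {P : AcqModel}

theorem continuousOn_f_Hstar (hP : P.Standing) :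
    ContinuousOn (fun g => P.f g (P.Hstar g)) (Icc 0 P.gmax) :=
  continuousOn_f_comp continuousOn_id (continuousOn_Hstar hP)

/-- Both effects have the same sign: `f` decreases in the state for a fixed rate, and the rate `H*`
increases with the state while `f` decreases in the rate. -/
theorem antitoneOn_f_Hstar (hP : P.Standing) :
    AntitoneOn (fun g => P.f g (P.Hstar g)) (Icc 0 P.gmax) := by
  intro a ha b hb hab
  refine le_trans ?_ (hP.f_anti ha.1 hab (Hstar_mem hP a).1)
  have := mul_le_mul_of_nonneg_right (monotoneOn_Hstar hP ha hb hab) (sq_nonneg b)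
  simp only [f]
  linarith

theorem IsClosedLoop.continuousOn {g0 : ℝ} {g : ℝ → ℝ} (hg : P.IsClosedLoop g0 g) :
    ContinuousOn g (Ici 0) := fun t ht => (hg.2 t ht).2.continuousWithinAt

theorem IsClosedLoop.eq_add_integral (hP : P.Standing) {g0 : ℝ} {g : ℝ → ℝ}
    (hg : P.IsClosedLoop g0 g) {t : ℝ} (ht : 0 ≤ t) :
    g t = g0 + ∫ s in (0 : ℝ)..t, P.f (g s) (P.Hstar (g s)) := by
  have hc : ContinuousOn (fun s => P.f (g s) (P.Hstar (g s))) (Ici 0) :=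
    (continuousOn_f_Hstar hP).comp hg.continuousOn fun s hs => (hg.2 s hs).1
  rw [intervalIntegral.integral_eq_sub_of_hasDeriv_right_of_le ht
    (hg.continuousOn.mono Icc_subset_Ici_self)
    (fun s hs => (hg.2 s hs.1.le).2.mono fun r hr => hs.1.le.trans (le_of_lt hr))
    (hc.mono (by rw [uIcc_of_le ht]; exact Icc_subset_Ici_self)).intervalIntegrable, hg.1]
  ring

/-- Solutions of the integrated closed-loop equation are classical. -/
theorem isClosedLoop_of_eq_add_integral (hP : P.Standing) {g0 : ℝ} {g : ℝ → ℝ}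
    (hc : ContinuousOn g (Ici 0)) (hm : ∀ t, 0 ≤ t → g t ∈ Icc 0 P.gmax)
    (hg : ∀ t, 0 ≤ t → g t = g0 + ∫ s in (0 : ℝ)..t, P.f (g s) (P.Hstar (g s))) :
    P.IsClosedLoop g0 g := by
  refine ⟨by simpa using hg 0 le_rfl, fun t ht => ⟨hm t ht, ?_⟩⟩
  have hφ : Continuous fun s => P.f (g (max s 0)) (P.Hstar (g (max s 0))) :=
    ((continuousOn_f_Hstar hP).comp hc hm).comp_continuous (f := fun s : ℝ => max s 0)
      (by fun_prop) fun s => mem_Ici.2 (le_max_right _ _)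
  have hd := ((hφ.integral_hasStrictDerivAt 0 t).hasDerivAt.const_add g0).hasDerivWithinAt
    (s := Ici 0)
  simp only [max_eq_left ht] at hd
  have heq : ∀ r ∈ Ici (0 : ℝ), g r =
      g0 + ∫ s in (0 : ℝ)..r, P.f (g (max s 0)) (P.Hstar (g (max s 0))) := by
    intro r hr
    rw [hg r hr]
    congr 1
    refine intervalIntegral.integral_congr fun s hs => ?_
    rw [uIcc_of_le hr] at hs
    simp only [max_eq_left hs.1]
  exact hd.congr heq (heq t ht)

end ClosedLoop

end AcqModel

/-! ### Assembly: optimality of the feedback and uniqueness. -/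

theorem mainTheorem2 (P : AcqModel) (hP : P.Standing) :
    -- the state and the cost are well defined for every admissible control
    (∀ g0 ∈ Set.Icc 0 P.gmax, ∀ h ∈ P.Adm,
      P.IsState h g0 (P.state h g0) ∧
      (∀ t, 0 ≤ t → P.state h g0 t ∈ Set.Icc 0 P.gmax) ∧
      (∀ g, P.IsState h g0 g → Set.EqOn g (P.state h g0) (Set.Ici 0)) ∧
      MeasureTheory.IntegrableOn
        (fun t => Real.exp (-P.del * t) * P.k (P.state h g0 t) (h t)) (Set.Ioi 0)) ∧
    -- the value function solves the reduced HJB equation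
    P.SolvesHJB P.value ∧
    -- the feedback control is the unique continuous optimal control
    ∀ g0 ∈ Set.Icc 0 P.gmax, ∃ gs : ℝ → ℝ,
      P.IsClosedLoop g0 gs ∧
      (∀ g, P.IsClosedLoop g0 g → Set.EqOn g gs (Set.Ici 0)) ∧
      Set.EqOn gs (P.state (fun t => P.Hstar (gs t)) g0) (Set.Ici 0) ∧
      ContinuousOn (fun t => P.Hstar (gs t)) (Set.Ici 0) ∧
      P.IsOptimal (fun t => P.Hstar (gs t)) g0 ∧
      ∀ h, P.IsOptimal h g0 → ContinuousOn h (Set.Ici 0) →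
        Set.EqOn h (fun t => P.Hstar (gs t)) (Set.Ici 0) := by
  refine ⟨fun g0 hg0 h hh => ?_, AcqModel.solvesHJB_value hP, fun g0 hg0 => ?_⟩
  · have hs := AcqModel.isState_state hP hh hg0
    exact ⟨hs, hs.mem_Icc hP hh hg0, fun g hg => hg.eqOn hP hh hg0.1 hs, hs.integrableOn_k hP hh hg0⟩
  have hFc := AcqModel.continuousOn_f_Hstar hP
  have hFa := AcqModel.antitoneOn_f_Hstar hP
  obtain ⟨gs, hc, hm, hgs⟩ := exists_eq_add_integral_of_antitoneOn hP.gmax_pos.le hFc hFa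
    (by simp only [AcqModel.f]; nlinarith [sq_nonneg P.sig2])
    (hP.f_nonpos le_rfl (AcqModel.Hstar_mem hP _).1) hg0
  have huniq : ∀ g : ℝ → ℝ, ContinuousOn g (Ici 0) → (∀ t, 0 ≤ t → g t ∈ Icc 0 P.gmax) →
      (∀ t, 0 ≤ t → g t = g0 + ∫ s in (0 : ℝ)..t, P.f (g s) (P.Hstar (g s))) →
      EqOn g gs (Ici 0) := fun g hgc hgm hg =>
    eqOn_of_eq_add_integral_of_antitoneOn hFc hFa hgc hc hgm hm hg hgs
  have hHc : ContinuousOn (fun t => P.Hstar (gs t)) (Ici 0) :=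
    (AcqModel.continuousOn_Hstar hP).comp hc hm
  have hadm : (fun t => P.Hstar (gs t)) ∈ P.Adm :=
    ⟨(continuousOn_iff_continuous_domRestrict.1 hHc).measurable,
      fun t _ => AcqModel.Hstar_mem hP _⟩
  have hstate : P.IsState (fun t => P.Hstar (gs t)) g0 gs := ⟨hc, hgs⟩
  refine ⟨gs, AcqModel.isClosedLoop_of_eq_add_integral hP hc hm hgs,
    fun g hg => huniq g hg.continuousOn (fun t ht => (hg.2 t ht).1)
      fun t ht => hg.eq_add_integral hP ht,
    hstate.eqOn hP hadm hg0.1 (AcqModel.isState_state hP hadm hg0), hHc, ⟨hadm, ?_⟩, ?_⟩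
  · rw [hstate.cost_eq_value_add hP hadm hg0]
    have : ∫ s in Ioi (0 : ℝ), Real.exp (-P.del * s) * P.gap (gs s) (P.Hstar (gs s)) = 0 :=
      setIntegral_eq_zero_of_forall_eq_zero fun s hs => by
        rw [AcqModel.gap_Hstar hP (hm s (le_of_lt hs)), mul_zero]
    rw [this, add_zero]
  · rintro h ⟨hh, hopt⟩ hcont
    have hs := AcqModel.isState_state hP hh hg0
    set g := P.state h g0
    have hgm := hs.mem_Icc hP hh hg0
    -- Optimality makes the integral of the nonnegative discounted gap zero, so the gap vanishes
    -- almost everywhere.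
    rw [hs.cost_eq_value_add hP hh hg0, add_eq_left, setIntegral_eq_zero_iff_of_nonneg_ae ?_
      (hs.integrableOn_gap hP hh hg0)] at hopt
    · have hae : h =ᵐ[volume.restrict (Ici 0)] fun t => P.Hstar (g t) := by
        rw [← restrict_Ioi_eq_restrict_Ici]
        filter_upwards [hopt, ae_restrict_mem measurableSet_Ioi] with s hs0 hs1
        have hs2 : 0 ≤ s := le_of_lt hs1
        refine AcqModel.eq_Hstar hP (hh.2 s hs2) ?_
        rw [AcqModel.gap_Hstar hP (hgm s hs2)]
        exact ((mul_eq_zero.1 hs0).resolve_left (Real.exp_pos _).ne').le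
      have hHg : ContinuousOn (fun t => P.Hstar (g t)) (Ici 0) :=
        (AcqModel.continuousOn_Hstar hP).comp hs.1 hgm
      have heq : EqOn h (fun t => P.Hstar (g t)) (Ici 0) :=
        Measure.eqOn_of_ae_eq hae hcont hHg (by simp [closure_Ioi])
      -- Once `h = H*(g)` everywhere, the state of `h` solves the closed-loop equation and must be
      -- `gs`.
      have hggs : EqOn g gs (Ici 0) := huniq g hs.1 hgm fun t ht => by
        rw [hs.2 t ht]
        congr 1
        refine intervalIntegral.integral_congr fun s hs => ?_
        rw [uIcc_of_le ht] at hs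
        simp only [heq hs.1]
      intro t ht
      rw [heq ht]
      simp only [hggs ht]
    · filter_upwards [ae_restrict_mem measurableSet_Ioi] with s hs1
      have hs2 : 0 ≤ s := le_of_lt hs1
      exact mul_nonneg (Real.exp_pos _).le (AcqModel.gap_nonneg hP (hgm s hs2) (hh.2 s hs2))
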